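/- **Setting.** For $T>0$ let $m_T(\xi)=\sqrt{(1+T\xi^2)\tanh(\xi)/\xi}$ ($m_T(0)=1$), and for $\kappa>0$ let $M_{T,\kappa}$ be the Fourier multiplier on $\mathbb T=\mathbb R/2\pi\mathbb Z$ with symbol $n\mapsto m_T(\kappa n)$, $n\in\mathbb Z$. A *solution* is a quadruple $(u,c,\kappa,T)\in L^\infty(\mathbb T;\mathbb R)\times(0,\infty)^3$ satisfying, in the sense of distributions, $$(M_{T,\kappa}-c)u+u^2=0 .$$ A function $u$ is *symmetric* if $x\mapsto u(x+a)$ is even for some $a\in\mathbb R$ (as an element of $L^\infty$, i.e. almost everywhere), and *asymmetric* otherwise. For integers $1\le k_1<k_2$, a triple $(c_0,\kappa_0,T_0)\in(0,\infty)^3$ is a *double bifurcation point with wave numbers* $(k_1,k_2)$ if, for integers $k\ge1$, $m_{T_0}(\kappa_0k)=c_0$ holds exactly when $k\in\{k_1,k_2\}$. We say that *there are no asymmetric solutions of arbitrarily small amplitude near* $(c_0,\kappa_0,T_0)$ if there is $\varepsilon>0$ such that every solution $(u,c,\kappa,T)$ with $\|u\|_{L^\infty}<\varepsilon$, $|c-c_0|<\varepsilon$,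 $|\kappa-\kappa_0|<\varepsilon$ and $|T-T_0|<\varepsilon$ has $u$ symmetric. **The function $\phi$.** For $T\in(0,\frac13)$ and $1\le k_1<k_2$ there is a unique $\kappa_0=\kappa_0(T;k_1,k_2)>0$ with $m_T(\kappa_0k_1)=m_T(\kappa_0k_2)$; let $c_0=c_0(T;k_1,k_2)$ be this common value. For $n\in\mathbb Z$ put $\ell(n)=(c_0-m_T(\kappa_0 n))^{-1}$ if $n\notin\{\pm k_1,\pm k_2\}$ and $\ell(n)=0$ otherwise. For multi-indices $\alpha,\beta\in\mathbb N_0^2$ define $\hat u_{\alpha,\beta}$ and $\widehat{u^2}_{\alpha,\beta}$ recursively by $\hat u_{0,0}=0$, $\hat u_{\alpha,\beta}=\frac12$ if $|\alpha|+|\beta|=1$, $$\widehat{u^2}_{\alpha,\beta}=\sum_{\substack{\alpha'+\alpha''=\alpha\\ \beta'+\beta''=\beta}}\hat u_{\alpha',\beta'}\,\hat u_{\alpha'',\beta''},\qquad \hat u_{\alpha,\beta}=\ell\big(k_1(\alpha_1-\beta_1)+k_2(\alpha_2-\beta_2)\big)\,\widehat{u^2}_{\alpha,\beta}\quad(|\alpha|+|\beta|\ge2),$$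 the sums running over pairs $(\alpha',\beta'),(\alpha'',\beta'')\ne(0,0)$. Set $\phi(T;k_1,k_2)=\widehat{u^2}_{(k_2-1,0),(0,k_1)}$. **Statement.** Let $1\le k_1<k_2$ be integers. 1. If $k_1,k_2$ are coprime and $\phi(T;k_1,k_2)\ne0$ for all $T\in(0,\frac13)$, then there are no asymmetric solutions of arbitrarily small amplitude near any double bifurcation point with wave numbers $(k_1,k_2)$. 2. If $k_1\mid k_2$ or $(k_2-k_1)\mid k_1$ (with $k_1,k_2$ not necessarily coprime), then there are no asymmetric solutions of arbitrarily small amplitude near any double bifurcation point with wave numbers $(k_1,k_2)$. -/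

import Mathlib

open MeasureTheory

namespace CapillaryWhitham

noncomputable section

/-- The dispersion symbol `m_T(ξ) = √((1 + T ξ²) tanh ξ / ξ)`, extended by its limit `1` at `ξ = 0`. -/
def symbol (T ξ : ℝ) : ℝ :=
  if ξ = 0 then 1 else Real.sqrt ((1 + T * ξ ^ 2) * Real.tanh ξ / ξ)

/-- The `n`-th Fourier coefficient `(2π)⁻¹ ∫₀^{2π} u(x) e^{-inx} dx` of a real function. -/
def fourierHat (u : ℝ → ℝ) (n : ℤ) : ℂ :=
  fourierCoeffOn Real.two_pi_pos (fun x => (u x : ℂ)) n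

/-- `(u, c, κ, T) ∈ L^∞(𝕋) × ℝ₊³` solves `(M_{T,κ} - c) u + u² = 0` in the sense of distributions
on `𝕋 = ℝ / 2πℤ`, where `M_{T,κ}` is the Fourier multiplier with symbol `ξ ↦ m_T(κ ξ)`.  A periodic
distribution vanishes exactly when all its Fourier coefficients do. -/
structure IsSolution (u : ℝ → ℝ) (c κ T : ℝ) : Prop where
  periodic : Function.Periodic u (2 * Real.pi)
  memLp : MemLp u ⊤ (volume : Measure ℝ)
  c_pos : 0 < c
  κ_pos : 0 < κ
  T_pos : 0 < T
  eqn : ∀ n : ℤ,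
    ((symbol T (κ * n) - c : ℝ) : ℂ) * fourierHat u n + fourierHat (fun x => u x ^ 2) n = 0

/-- `u` is symmetric if some translate of it is even.  As elements of `L^∞` are considered, equality
is almost everywhere; for continuous `u` it is equality everywhere, see `isSymmetric_iff`. -/
def IsSymmetric (u : ℝ → ℝ) : Prop :=
  ∃ a : ℝ, ∀ᵐ x : ℝ, u (-x + a) = u (x + a)

def IsAsymmetric (u : ℝ → ℝ) : Prop := ¬ IsSymmetric u

theorem isSymmetric_iff {u : ℝ → ℝ} (hu : Continuous u) :
    IsSymmetric u ↔ ∃ a : ℝ, Function.Even (fun x => u (x + a)) := by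
  constructor
  · rintro ⟨a, ha⟩
    refine ⟨a, fun x => ?_⟩
    have h : (fun x : ℝ => u (-x + a)) = fun x => u (x + a) :=
      Measure.eq_of_ae_eq (μ := volume) ha (by fun_prop) (by fun_prop)
    exact congrFun h x
  · rintro ⟨a, ha⟩
    exact ⟨a, Filter.Eventually.of_forall fun x => ha x⟩

/-- `(c, κ, T) ∈ ℝ₊³` is a double bifurcation point with wave numbers `k₁ < k₂`: these are exactly
the positive integers `k` with `m_T(κ k) = c`. -/
structure IsDoubleBifurcationPoint (k₁ k₂ : ℕ) (c κ T : ℝ) : Prop where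
  c_pos : 0 < c
  κ_pos : 0 < κ
  T_pos : 0 < T
  one_le : 1 ≤ k₁
  lt : k₁ < k₂
  eq_iff : ∀ k : ℕ, 1 ≤ k → (symbol T (κ * k) = c ↔ k = k₁ ∨ k = k₂)

/-- There are no asymmetric solutions of arbitrarily small amplitude near `(c₀, κ₀, T₀)`: some
neighbourhood of `(0, c₀, κ₀, T₀)` in `L^∞(𝕋) × ℝ³` contains no asymmetric solution. -/
def NoSmallAsymmetricSolutionsNear (c₀ κ₀ T₀ : ℝ) : Prop :=
  ∃ ε : ℝ, 0 < ε ∧ ∀ (u : ℝ → ℝ) (c κ T : ℝ), IsSolution u c κ T →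
    eLpNorm u ⊤ (volume : Measure ℝ) < ENNReal.ofReal ε →
    |c - c₀| < ε → |κ - κ₀| < ε → |T - T₀| < ε → ¬ IsAsymmetric u

/-- Pairs `(α, β)` of multi-indices in `ℕ²`. -/
abbrev MultiIndexPair : Type := (ℕ × ℕ) × (ℕ × ℕ)

/-- The total degree `|α| + |β|`. -/
def degree (a : MultiIndexPair) : ℕ := (a.1.1 + a.1.2) + (a.2.1 + a.2.2)

/-- The frequency `k₁ (α₁ - β₁) + k₂ (α₂ - β₂)`. -/
def frequency (k₁ k₂ : ℕ) (a : MultiIndexPair) : ℤ :=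
  k₁ * ((a.1.1 : ℤ) - a.2.1) + k₂ * ((a.1.2 : ℤ) - a.2.2)

/-- The symbol of `(c - M_{T,κ})⁻¹ P_W`, where `P_W` removes the frequencies `±k₁, ±k₂`. -/
def ell (k₁ k₂ : ℕ) (c κ T : ℝ) (n : ℤ) : ℝ :=
  if n.natAbs = k₁ ∨ n.natAbs = k₂ then 0 else (c - symbol T (κ * n))⁻¹

theorem degree_lt {a b : MultiIndexPair} (h : b < a) : degree b < degree a := by
  obtain ⟨⟨a1, a2⟩, a3, a4⟩ := a
  obtain ⟨⟨b1, b2⟩, b3, b4⟩ := b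
  rw [lt_iff_le_and_ne] at h
  simp only [Prod.mk_le_mk, ne_eq, Prod.mk.injEq] at h
  simp only [degree]
  omega

theorem degree_sub_lt {a b : MultiIndexPair} (h0 : 0 < b) (h : b < a) :
    degree (a - b) < degree a := by
  obtain ⟨⟨a1, a2⟩, a3, a4⟩ := a
  obtain ⟨⟨b1, b2⟩, b3, b4⟩ := b
  have h0 := degree_lt h0
  have h := h.le
  simp only [Prod.mk_le_mk] at h
  simp only [degree, Prod.mk_sub_mk, Prod.fst_zero, Prod.snd_zero] at h0 ⊢
  omega

/-- The coefficients `û_{α,β}` of the Taylor--Fourier expansion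
`u = v + w = ∑ û_{α,β} r^{α+β} E^{α-β}`, with `E = (e^{ik₁(x+θ₁)}, e^{ik₂(x+θ₂)})`, of the solution of
`w = L (v + w)²`, where `L` has the symbol `l` and
`v = r₁ cos (k₁ (x + θ₁)) + r₂ cos (k₂ (x + θ₂))`.  They are `0` in degree `0` and `1/2` in degree
`1`, and in higher degree they follow by comparing coefficients.  The index set
`Finset.Ioo 0 (α, β)` describes the splittings `(α', β') + (α'', β'') = (α, β)` into two nonzero
summands. -/
def uHat (k₁ k₂ : ℕ) (l : ℤ → ℝ) (a : MultiIndexPair) : ℝ :=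
  if degree a = 1 then 1 / 2
  else l (frequency k₁ k₂ a) *
    ∑ b ∈ (Finset.Ioo 0 a).attach, uHat k₁ k₂ l b.1 * uHat k₁ k₂ l (a - b.1)
termination_by degree a
decreasing_by
  · exact degree_lt (Finset.mem_Ioo.1 b.2).2
  · exact degree_sub_lt (Finset.mem_Ioo.1 b.2).1 (Finset.mem_Ioo.1 b.2).2

/-- The coefficients of `u²` in the same expansion. -/
def uSqHat (k₁ k₂ : ℕ) (l : ℤ → ℝ) (a : MultiIndexPair) : ℝ :=
  ∑ b ∈ Finset.Ioo 0 a, uHat k₁ k₂ l b * uHat k₁ k₂ l (a - b)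

theorem uHat_eq (k₁ k₂ : ℕ) (l : ℤ → ℝ) (a : MultiIndexPair) :
    uHat k₁ k₂ l a =
      if degree a = 1 then 1 / 2 else l (frequency k₁ k₂ a) * uSqHat k₁ k₂ l a := by
  rw [uHat, uSqHat,
    Finset.sum_attach (Finset.Ioo 0 a) (fun b => uHat k₁ k₂ l b * uHat k₁ k₂ l (a - b))]

/-- For `T ∈ (0, 1/3)` and `1 ≤ k₁ < k₂`, the unique `κ₀ > 0` with `m_T(κ₀ k₁) = m_T(κ₀ k₂)`. -/
def kappaZero (k₁ k₂ : ℕ) (T : ℝ) : ℝ :=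
  Classical.epsilon fun κ : ℝ => 0 < κ ∧ symbol T (κ * k₁) = symbol T (κ * k₂)

/-- `c₀ = m_T(κ₀ k₁)`. -/
def cZero (k₁ k₂ : ℕ) (T : ℝ) : ℝ := symbol T (kappaZero k₁ k₂ T * k₁)

/-- `φ(T; k₁, k₂)`: the coefficient of `u²` with multi-indices `(k₂ - 1, 0)` and `(0, k₁)`, at
`(c₀, κ₀, T)`. -/
def phi (k₁ k₂ : ℕ) (T : ℝ) : ℝ :=
  uSqHat k₁ k₂ (ell k₁ k₂ (cZero k₁ k₂ T) (kappaZero k₁ k₂ T) T) ((k₂ - 1, 0), (0, k₁))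

end

end CapillaryWhitham

open CapillaryWhitham

/-! A Lyapunov–Schmidt argument with explicit power series. Near a double bifurcation point a small
solution `u` is determined by its Fourier coefficients `z₁`, `z₂` at `k₁`, `k₂`: off the kernel
frequencies the equation reads `w = L u²` with `L` bounded, so the recursive series `expansion`
converges, and a contraction estimate in L² identifies it with `u` (`ae_eq_expansion`).

Write `k₁ = d p`, `k₂ = d q` with `p`, `q` coprime. One scalar consequence of the equation is still
available: at frequency `-k₁`, multiplied by `z₁`, it says that `z₁` times a Fourier coefficient of
`u²` is real. Each term of the imaginary part carries a phase `sin (m θ)` with `θ = q arg z₁ - p arg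
z₂`, hence is controlled by the common factor `|z₁|^q |z₂|^p |sin θ|`. The lowest-order term has the
coefficient `φ`, and every other one has at least one more power of the amplitude. If `φ ≠ 0`, the
leading term dominates unless the common factor vanishes (`resonance_vanishes`). When it vanishes, a
translation makes both `z₁` and `z₂` real (`exists_shift_real`); all coefficients of the expansion
are then real and the translate of `u` is even.

The estimates are uniform near the bifurcation point by continuity at finitely many frequencies and
growth of the symbol at the others (`eventually_nonresonant`). It remains to know `φ ≠ 0`. This is
assumed in the first claim, where uniqueness of `κ₀` matches `phi` with the given point. In the
second, the unimodal shape of the symbol gives `ℓ` one fixed sign at all frequencies occurring in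
the recursion, so nothing can cancel (`uSqHat_ne_zero_of_sign`). -/

/-! ### Hyperbolic inequalities. -/

theorem pos_of_hasDerivAt_pos {f f' : ℝ → ℝ} (h0 : f 0 = 0) (hd : ∀ x, HasDerivAt f (f' x) x)
    (hpos : ∀ x, 0 < x → 0 < f' x) {x : ℝ} (hx : 0 < x) : 0 < f x := by
  have hmono : StrictMonoOn f (Set.Ici 0) := by
    refine strictMonoOn_of_deriv_pos (convex_Ici 0)
      (fun y _ => (hd y).continuousAt.continuousWithinAt) fun y hy => ?_
    rw [interior_Ici, Set.mem_Ioi] at hy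
    rw [(hd y).deriv]
    exact hpos y hy
  have := hmono (Set.mem_Ici.2 le_rfl) (Set.mem_Ici.2 hx.le) hx
  rwa [h0] at this

namespace Real

theorem sinh_lt_mul_cosh {x : ℝ} (hx : 0 < x) : sinh x < x * cosh x := by
  have := pos_of_hasDerivAt_pos (f := fun y => y * cosh y - sinh y) (f' := fun y => y * sinh y)
    (by simp) (fun y => by
      refine HasDerivAt.congr_deriv (((hasDerivAt_id' y).mul (hasDerivAt_cosh y)).sub (hasDerivAt_sinh y)) ?_
      ring) (fun y hy => mul_pos hy (sinh_pos_iff.2 hy)) hx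
  linarith

theorem one_add_sq_lt_cosh {x : ℝ} (hx : 0 < x) : 1 + x ^ 2 / 2 < cosh x := by
  have := pos_of_hasDerivAt_pos (f := fun y => cosh y - (1 + y ^ 2 / 2))
    (f' := fun y => sinh y - y) (by simp) (fun y => by
      refine HasDerivAt.congr_deriv ((hasDerivAt_cosh y).sub ((((hasDerivAt_id' y).pow 2).div_const 2).const_add 1)) ?_
      simp) (fun y hy => sub_pos.2 (self_lt_sinh_iff.2 hy)) hx
  linarith

theorem add_cube_lt_sinh {x : ℝ} (hx : 0 < x) : x + x ^ 3 / 6 < sinh x := by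
  have := pos_of_hasDerivAt_pos (f := fun y => sinh y - (y + y ^ 3 / 6))
    (f' := fun y => cosh y - (1 + y ^ 2 / 2)) (by simp) (fun y => by
      refine HasDerivAt.congr_deriv ((hasDerivAt_sinh y).sub
        ((hasDerivAt_id' y).add (((hasDerivAt_id' y).pow 3).div_const 6))) ?_
      simp
      ring) (fun y hy => sub_pos.2 (one_add_sq_lt_cosh hy)) hx
  linarith

/-- The Taylor bound `x - x³/3 < tanh x`, cleared of denominators. -/
theorem sub_cube_mul_cosh_lt_sinh {x : ℝ} (hx : 0 < x) :
    (3 * x - x ^ 3) * cosh x < 3 * sinh x := by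
  have := pos_of_hasDerivAt_pos (f := fun y => 3 * sinh y - (3 * y - y ^ 3) * cosh y)
    (f' := fun y => y * (3 * (y * cosh y - sinh y) + y ^ 2 * sinh y)) (by simp) (fun y => by
      refine HasDerivAt.congr_deriv (((hasDerivAt_sinh y).const_mul 3).sub
        ((((hasDerivAt_id' y).const_mul 3).sub ((hasDerivAt_id' y).pow 3)).mul
          (hasDerivAt_cosh y))) ?_
      simp
      ring) (fun y hy => by
        have h1 := sinh_lt_mul_cosh hy
        have h2 := sinh_pos_iff.2 hy
        have : 0 < y * cosh y - sinh y := by linarith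
        positivity) hx
  linarith

/-- Gives the sign of the derivative of `criticalT`. In the cubic lower bounds for `sinh` and `tanh`
the terms in `x⁴ cosh x` cancel, leaving a surplus `x⁶ cosh x / 36`. -/
theorem two_mul_sq_mul_cosh_lt {x : ℝ} (hx : 0 < x) :
    2 * x ^ 2 * cosh x < sinh x ^ 2 * cosh x + x * sinh x := by
  have h1 := add_cube_lt_sinh hx
  have h2 := sub_cube_mul_cosh_lt_sinh hx
  have hc := cosh_pos x
  have h3 : (x + x ^ 3 / 6) ^ 2 < sinh x ^ 2 := by gcongr
  have h4 : (x + x ^ 3 / 6) ^ 2 * cosh x < sinh x ^ 2 * cosh x := by gcongr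
  have h5 : x * ((3 * x - x ^ 3) * cosh x) < x * (3 * sinh x) := by gcongr
  have h6 : 0 < x ^ 6 * cosh x := by positivity
  nlinarith

/-- Amounts to `criticalT x < 1/3`. In the variable `y = 2x` the difference and its first three
derivatives vanish at `0`, and the fourth is visibly positive. -/
theorem three_mul_sinh_mul_cosh_lt {x : ℝ} (hx : 0 < x) :
    3 * (sinh x * cosh x - x) < x ^ 2 * (sinh x * cosh x + x) := by
  have h3 : ∀ y : ℝ, 0 < y → 0 < 6 * y * sinh y + y ^ 2 * cosh y + 6 - 6 * cosh y := fun y hy =>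
    pos_of_hasDerivAt_pos (f := fun y => 6 * y * sinh y + y ^ 2 * cosh y + 6 - 6 * cosh y)
      (f' := fun y => 8 * y * cosh y + y ^ 2 * sinh y) (by simp) (fun y => by
        refine HasDerivAt.congr_deriv (((((((hasDerivAt_id' y).const_mul 6).mul (hasDerivAt_sinh y)).add
          (((hasDerivAt_id' y).pow 2).mul (hasDerivAt_cosh y))).add_const 6).sub
          ((hasDerivAt_cosh y).const_mul 6))) ?_
        simp
        ring) (fun y hy => by have := sinh_pos_iff.2 hy; have := cosh_pos y; positivity) hy
  have h2 : ∀ y : ℝ, 0 < y → 0 < 4 * y * cosh y + y ^ 2 * sinh y + 6 * y - 10 * sinh y :=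
    fun y hy => pos_of_hasDerivAt_pos
      (f := fun y => 4 * y * cosh y + y ^ 2 * sinh y + 6 * y - 10 * sinh y)
      (by simp) (fun y => by
        refine HasDerivAt.congr_deriv (((((((hasDerivAt_id' y).const_mul 4).mul (hasDerivAt_cosh y)).add
          (((hasDerivAt_id' y).pow 2).mul (hasDerivAt_sinh y))).add
          ((hasDerivAt_id' y).const_mul 6)).sub ((hasDerivAt_sinh y).const_mul 10))) ?_
        simp
        ring) h3 hy
  have h1 : ∀ y : ℝ, 0 < y →
      0 < 2 * y * sinh y + y ^ 2 * cosh y + 3 * y ^ 2 - 12 * cosh y + 12 :=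
    fun y hy => pos_of_hasDerivAt_pos
      (f := fun y => 2 * y * sinh y + y ^ 2 * cosh y + 3 * y ^ 2 - 12 * cosh y + 12)
      (by simp) (fun y => by
        refine HasDerivAt.congr_deriv ((((((((hasDerivAt_id' y).const_mul 2).mul (hasDerivAt_sinh y)).add
          (((hasDerivAt_id' y).pow 2).mul (hasDerivAt_cosh y))).add
          (((hasDerivAt_id' y).pow 2).const_mul 3)).sub
          ((hasDerivAt_cosh y).const_mul 12)).add_const 12)) ?_
        simp
        ring) h2 hy
  have h0 : 0 < (2 * x) ^ 2 * (sinh (2 * x) + 2 * x) - 12 * (sinh (2 * x) - 2 * x) :=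
    pos_of_hasDerivAt_pos
      (f := fun y => y ^ 2 * (sinh y + y) - 12 * (sinh y - y))
      (by simp) (fun y => by
        refine HasDerivAt.congr_deriv (((((hasDerivAt_id' y).pow 2).mul
          ((hasDerivAt_sinh y).add (hasDerivAt_id' y))).sub
          (((hasDerivAt_sinh y).sub (hasDerivAt_id' y)).const_mul 12))) ?_
        simp
        ring) h1 (by positivity)
  rw [sinh_two_mul] at h0
  nlinarith

end Real

/-! ### Shape of the dispersion symbol and uniqueness of `κ₀`. -/

namespace CapillaryWhitham

open Real Set Filter Topology

/-- The value of `T` for which `ξ` is a critical point of `symbol T`. -/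
noncomputable def criticalT (x : ℝ) : ℝ :=
  (sinh x * cosh x - x) / (x ^ 2 * (sinh x * cosh x + x))

theorem criticalT_denom_pos {x : ℝ} (hx : 0 < x) : 0 < x ^ 2 * (sinh x * cosh x + x) := by
  have := sinh_pos_iff.2 hx
  have := cosh_pos x
  positivity

theorem hasDerivAt_sinh_mul_cosh (x : ℝ) :
    HasDerivAt (fun y => sinh y * cosh y) (cosh x ^ 2 + sinh x ^ 2) x := by
  refine HasDerivAt.congr_deriv ((hasDerivAt_sinh x).mul (hasDerivAt_cosh x)) ?_
  ring

/-- Ensures that `T - criticalT x` changes sign at most once, so the symbol has at most one critical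
point on the half-line. -/
theorem criticalT_strictAntiOn : StrictAntiOn criticalT (Ioi 0) := by
  have hd : ∀ x : ℝ, 0 < x → HasDerivAt criticalT
      (((cosh x ^ 2 + sinh x ^ 2 - 1) * (x ^ 2 * (sinh x * cosh x + x)) -
        (sinh x * cosh x - x) * (2 * x * (sinh x * cosh x + x) +
          x ^ 2 * (cosh x ^ 2 + sinh x ^ 2 + 1))) /
        (x ^ 2 * (sinh x * cosh x + x)) ^ 2) x := fun x hx => by
    refine HasDerivAt.congr_deriv ((((hasDerivAt_sinh_mul_cosh x).sub (hasDerivAt_id' x)).div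
      (((hasDerivAt_id' x).pow 2).mul ((hasDerivAt_sinh_mul_cosh x).add (hasDerivAt_id' x)))
      (criticalT_denom_pos hx).ne')) ?_
    simp
  refine strictAntiOn_of_deriv_neg (convex_Ioi 0)
    (fun x hx => (hd x hx).continuousAt.continuousWithinAt) fun x hx => ?_
  rw [interior_Ioi, mem_Ioi] at hx
  rw [(hd x hx).deriv]
  refine div_neg_of_neg_of_pos ?_ (pow_pos (criticalT_denom_pos hx) 2)
  have h1 := two_mul_sq_mul_cosh_lt hx
  have hc := cosh_sq x
  have : ((cosh x ^ 2 + sinh x ^ 2 - 1) * (x ^ 2 * (sinh x * cosh x + x)) -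
        (sinh x * cosh x - x) * (2 * x * (sinh x * cosh x + x) +
          x ^ 2 * (cosh x ^ 2 + sinh x ^ 2 + 1))) =
      2 * x * cosh x * (2 * x ^ 2 * cosh x - (sinh x ^ 2 * cosh x + x * sinh x)) := by
    have hs : sinh x ^ 2 = cosh x ^ 2 - 1 := by linarith
    ring_nf
    simp only [hs]
    ring
  rw [this]
  exact mul_neg_of_pos_of_neg (by have := cosh_pos x; positivity) (by linarith)

theorem criticalT_lt {x : ℝ} (hx : 0 < x) : criticalT x < 1 / 3 := by
  rw [criticalT, div_lt_div_iff₀ (criticalT_denom_pos hx) (by norm_num)]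
  linarith [three_mul_sinh_mul_cosh_lt hx]

/-- The square of the symbol away from the origin. -/
noncomputable def symbolSq (T x : ℝ) : ℝ := (1 + T * x ^ 2) * Real.tanh x / x

theorem tanh_pos {x : ℝ} (hx : 0 < x) : 0 < Real.tanh x := by
  rw [Real.tanh_eq_sinh_div_cosh]
  exact div_pos (sinh_pos_iff.2 hx) (cosh_pos x)

theorem symbolSq_pos {T x : ℝ} (hT : 0 < T) (hx : 0 < x) : 0 < symbolSq T x := by
  have := tanh_pos hx
  rw [symbolSq]
  positivity

theorem symbol_eq {T x : ℝ} (hx : 0 < x) : symbol T x = √(symbolSq T x) := by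
  rw [symbol, if_neg hx.ne', symbolSq]

theorem symbol_lt_symbol_iff {T x y : ℝ} (hT : 0 < T) (hx : 0 < x) (hy : 0 < y) :
    symbol T x < symbol T y ↔ symbolSq T x < symbolSq T y := by
  rw [symbol_eq hx, symbol_eq hy, sqrt_lt_sqrt_iff (symbolSq_pos hT hx).le]

theorem symbol_zero (T : ℝ) : symbol T 0 = 1 := if_pos rfl

theorem symbol_neg (T x : ℝ) : symbol T (-x) = symbol T x := by
  simp [symbol, Real.tanh_neg]

theorem symbol_mul_natAbs (T κ : ℝ) (n : ℤ) : symbol T (κ * n) = symbol T (κ * n.natAbs) := by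
  rw [Nat.cast_natAbs, Int.cast_abs]
  rcases abs_choice (n : ℝ) with h | h
  · rw [h]
  · rw [h, mul_neg, symbol_neg]

theorem symbolSq_eq (T : ℝ) :
    symbolSq T = fun x => (1 + T * x ^ 2) * sinh x / (x * cosh x) := by
  funext x
  rw [symbolSq, Real.tanh_eq_sinh_div_cosh]
  have := (cosh_pos x).ne'
  field_simp

/-- The second factor is positive, so the sign is that of `T - criticalT x`. -/
theorem hasDerivAt_symbolSq (T : ℝ) {x : ℝ} (hx : 0 < x) :
    HasDerivAt (symbolSq T)
      ((T - criticalT x) * ((sinh x * cosh x + x) / cosh x ^ 2)) x := by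
  have hc := (cosh_pos x).ne'
  have hs := sinh_pos_iff.2 hx
  have hc' := cosh_pos x
  have hd : sinh x * cosh x + x ≠ 0 := by positivity
  rw [symbolSq_eq]
  refine HasDerivAt.congr_deriv ((((((hasDerivAt_id' x).pow 2).const_mul T).const_add 1).mul (hasDerivAt_sinh x)).div
    ((hasDerivAt_id' x).mul (hasDerivAt_cosh x)) (mul_ne_zero hx.ne' hc)) ?_
  rw [criticalT]
  simp only [Nat.cast_ofNat, Nat.add_one_sub_one, pow_one, mul_one, one_mul]
  field_simp
  have hs2 : sinh x ^ 2 = cosh x ^ 2 - 1 := by linarith [cosh_sq x]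
  simp only [Pi.mul_apply, Pi.pow_apply]
  ring_nf
  simp only [hs2]
  ring

theorem tendsto_symbolSq (T : ℝ) : Tendsto (symbolSq T) (𝓝[>] 0) (𝓝 1) := by
  have h1 : Tendsto (fun x : ℝ => x⁻¹ * sinh x) (𝓝[>] 0) (𝓝 1) := by
    have := (hasDerivAt_iff_tendsto_slope_zero.1 (hasDerivAt_sinh 0)).mono_left
      (nhdsWithin_mono 0 (s := Ioi 0) fun x hx => ne_of_gt hx)
    simpa using this
  have h2 : Tendsto (fun x : ℝ => (1 + T * x ^ 2) / cosh x) (𝓝[>] 0) (𝓝 1) := by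
    have : ContinuousAt (fun x : ℝ => (1 + T * x ^ 2) / cosh x) 0 :=
      ContinuousAt.div (by fun_prop) continuous_cosh.continuousAt (cosh_pos 0).ne'
    have := this.tendsto.mono_left (nhdsWithin_le_nhds (s := Ioi 0))
    simpa using this
  have := h2.mul h1
  rw [mul_one] at this
  refine this.congr fun x => ?_
  rw [symbolSq_eq]
  simp only [div_eq_mul_inv, mul_inv]
  ring

/-- The shape of the symbol when it takes the same value twice. -/
theorem symbol_unimodal {T a b : ℝ} (hT : 0 < T) (ha : 0 < a) (hab : a < b)
    (h : symbol T a = symbol T b) :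
    T < 1 / 3 ∧ symbol T a < 1 ∧ (∀ x, a < x → x < b → symbol T x < symbol T a) ∧
      (∀ x, 0 < x → x < a → symbol T a < symbol T x) ∧ (∀ x, b < x → symbol T a < symbol T x) := by
  have hb : 0 < b := ha.trans hab
  have hsq : symbolSq T a = symbolSq T b := by
    rcases lt_trichotomy (symbolSq T a) (symbolSq T b) with h' | h' | h'
    · exact absurd ((symbol_lt_symbol_iff hT ha hb).2 h') (by rw [h]; exact lt_irrefl _)
    · exact h'
    · exact absurd ((symbol_lt_symbol_iff hT hb ha).2 h') (by rw [h]; exact lt_irrefl _)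
  have hcont : ∀ x, 0 < x → ContinuousAt (symbolSq T) x := fun x hx =>
    (hasDerivAt_symbolSq T hx).continuousAt
  have hfac : ∀ x, 0 < x → 0 < (sinh x * cosh x + x) / cosh x ^ 2 := fun x hx => by
    have := sinh_pos_iff.2 hx
    have := cosh_pos x
    positivity
  -- Rolle: `ξ` is the minimum point. Monotonicity of `criticalT` makes the symbol decrease before
  -- it and increase after it.
  obtain ⟨ξ, ⟨haξ, hξb⟩, hξ⟩ := exists_hasDerivAt_eq_zero hab
    (fun x hx => (hcont x (ha.trans_le hx.1)).continuousWithinAt) hsq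
    (fun x hx => hasDerivAt_symbolSq T (ha.trans hx.1))
  have hξ0 : 0 < ξ := ha.trans haξ
  have hTξ : T = criticalT ξ := by
    rcases mul_eq_zero.1 hξ with h' | h'
    · linarith
    · exact absurd h' (hfac ξ hξ0).ne'
  have hanti : StrictAntiOn (symbolSq T) (Ioc 0 ξ) := by
    refine strictAntiOn_of_deriv_neg (convex_Ioc 0 ξ)
      (fun x hx => (hcont x hx.1).continuousWithinAt) fun x hx => ?_
    rw [interior_Ioc] at hx
    rw [(hasDerivAt_symbolSq T hx.1).deriv]
    refine mul_neg_of_neg_of_pos ?_ (hfac x hx.1)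
    have := criticalT_strictAntiOn (mem_Ioi.2 hx.1) (mem_Ioi.2 hξ0) hx.2
    linarith
  have hmono : StrictMonoOn (symbolSq T) (Ici ξ) := by
    refine strictMonoOn_of_deriv_pos (convex_Ici ξ)
      (fun x hx => (hcont x (hξ0.trans_le hx)).continuousWithinAt) fun x hx => ?_
    rw [interior_Ici, mem_Ioi] at hx
    rw [(hasDerivAt_symbolSq T (hξ0.trans hx)).deriv]
    refine mul_pos ?_ (hfac x (hξ0.trans hx))
    have := criticalT_strictAntiOn (mem_Ioi.2 hξ0) (mem_Ioi.2 (hξ0.trans hx)) hx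
    linarith
  refine ⟨hTξ ▸ criticalT_lt hξ0, ?_, ?_, ?_, ?_⟩
  -- On the decreasing branch the values stay below the limit `1` at the origin; the intermediate
  -- point `a / 2` makes the inequality strict.
  · have h1 : symbolSq T (a / 2) ≤ 1 := by
      refine ge_of_tendsto (tendsto_symbolSq T) ?_
      filter_upwards [Ioo_mem_nhdsGT (show (0 : ℝ) < a / 2 by positivity)] with x hx
      exact (hanti ⟨hx.1, by linarith [hx.2]⟩ ⟨by positivity, by linarith⟩ hx.2).le
    have h2 : symbolSq T a < symbolSq T (a / 2) :=
      hanti ⟨by positivity, by linarith⟩ ⟨ha, haξ.le⟩ (by linarith)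
    rw [symbol_eq ha, sqrt_lt' one_pos]
    linarith
  · intro x hax hxb
    rw [symbol_lt_symbol_iff hT (ha.trans hax) ha]
    rcases le_total x ξ with hx | hx
    · exact hanti ⟨ha, haξ.le⟩ ⟨ha.trans hax, hx⟩ hax
    · rw [hsq]
      exact hmono hx hξb.le hxb
  · intro x hx hxa
    rw [symbol_lt_symbol_iff hT ha hx]
    exact hanti ⟨hx, (hxa.trans haξ).le⟩ ⟨ha, haξ.le⟩ hxa
  · intro x hbx
    rw [symbol_lt_symbol_iff hT ha (hb.trans hbx), hsq]
    exact hmono hξb.le (hξb.trans hbx).le hbx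

/-- Two equal-value pairs in the same ratio cannot both fit a unimodal profile: the larger pair has
its right end above the first level, while its left end is either inside the first interval, and so
below that level, or at or beyond `κ b`, where the two profiles conflict. -/
theorem not_lt_of_symbol_eq {T a b κ κ' : ℝ} (hT : 0 < T) (ha : 0 < a) (hab : a < b) (hκ : 0 < κ)
    (h : symbol T (κ * a) = symbol T (κ * b)) (h' : symbol T (κ' * a) = symbol T (κ' * b)) :
    ¬ κ < κ' := by
  intro hlt
  have hκ' : 0 < κ' := hκ.trans hlt
  have hb : 0 < b := ha.trans hab
  obtain ⟨-, -, hin, -, hout⟩ := symbol_unimodal hT (mul_pos hκ ha) (by gcongr) h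
  obtain ⟨-, -, -, hleft, -⟩ := symbol_unimodal hT (mul_pos hκ' ha) (by gcongr) h'
  have h1 : κ * a < κ' * a := by gcongr
  have h2 : κ * b < κ' * b := by gcongr
  rcases lt_trichotomy (κ' * a) (κ * b) with h3 | h3 | h3
  · have := hin _ h1 h3
    have := hout _ h2
    linarith
  · have := hout _ h2
    rw [h3] at h'
    linarith
  · have := hleft (κ * b) (by positivity) h3
    have := hout _ h3
    linarith

theorem kappaZero_eq {k₁ k₂ : ℕ} (hk₁ : 1 ≤ k₁) (hk : k₁ < k₂) {κ T : ℝ} (hT : 0 < T) (hκ : 0 < κ)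
    (h : symbol T (κ * k₁) = symbol T (κ * k₂)) : kappaZero k₁ k₂ T = κ := by
  obtain ⟨hpos, heq⟩ : 0 < kappaZero k₁ k₂ T ∧
      symbol T (kappaZero k₁ k₂ T * k₁) = symbol T (kappaZero k₁ k₂ T * k₂) :=
    Classical.epsilon_spec (p := fun κ : ℝ => 0 < κ ∧ symbol T (κ * k₁) = symbol T (κ * k₂))
      ⟨κ, hκ, h⟩
  have hk₁' : (0 : ℝ) < k₁ := by exact_mod_cast hk₁
  have hk' : (k₁ : ℝ) < k₂ := by exact_mod_cast hk
  exact le_antisymm (not_lt.1 (not_lt_of_symbol_eq hT hk₁' hk' hκ h heq))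
    (not_lt.1 (not_lt_of_symbol_eq hT hk₁' hk' hpos heq h))

end CapillaryWhitham

/-! ### Taylor–Fourier coefficients and absolute convergence. -/

namespace CapillaryWhitham

noncomputable instance : Finset.HasAntidiagonal MultiIndexPair :=
  Finset.HasAntidiagonal.antidiagonalOfLocallyFinite

theorem degree_add (a b : MultiIndexPair) : degree (a + b) = degree a + degree b := by
  simp only [degree, Prod.fst_add, Prod.snd_add]
  omega

theorem degree_zero : degree 0 = 0 := rfl

theorem degree_eq_zero {a : MultiIndexPair} (h : degree a = 0) : a = 0 := by
  obtain ⟨⟨a1, a2⟩, a3, a4⟩ := a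
  simp only [degree] at h
  simp only [Prod.mk_eq_zero]
  omega

theorem le_of_degree_le {a : MultiIndexPair} {N : ℕ} (h : degree a ≤ N) :
    a ≤ ((N, N), (N, N)) := by
  obtain ⟨⟨a1, a2⟩, a3, a4⟩ := a
  simp only [degree] at h
  simp only [Prod.mk_le_mk]
  omega

theorem eq_of_degree_eq_one {a : MultiIndexPair} (h : degree a = 1) :
    a = ((1, 0), (0, 0)) ∨ a = ((0, 1), (0, 0)) ∨ a = ((0, 0), (1, 0)) ∨ a = ((0, 0), (0, 1)) := by
  obtain ⟨⟨a1, a2⟩, a3, a4⟩ := a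
  simp only [degree] at h
  simp only [Prod.mk.injEq]
  omega

theorem frequency_add (k₁ k₂ : ℕ) (a b : MultiIndexPair) :
    frequency k₁ k₂ (a + b) = frequency k₁ k₂ a + frequency k₁ k₂ b := by
  simp only [frequency, Prod.fst_add, Prod.snd_add]
  push_cast
  ring

section coefficients

variable (k₁ k₂ : ℕ) (l : ℤ → ℝ)

theorem uSqHat_zero : uSqHat k₁ k₂ l 0 = 0 := by simp [uSqHat]

theorem uHat_zero : uHat k₁ k₂ l 0 = 0 := by
  rw [uHat_eq, uSqHat_zero, degree_zero]
  simp

/-- The two extra splittings contribute nothing because `uHat` vanishes at `0`; this is the form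
needed for Cauchy products. -/
theorem uSqHat_eq_sum_antidiagonal (a : MultiIndexPair) :
    uSqHat k₁ k₂ l a =
      ∑ b ∈ Finset.HasAntidiagonal.antidiagonal a, uHat k₁ k₂ l b.1 * uHat k₁ k₂ l b.2 := by
  rw [uSqHat]
  refine Finset.sum_of_injOn (fun b => (b, a - b)) ?_ ?_ ?_ ?_
  · intro b _ c _ h
    exact (Prod.mk.inj h).1
  · intro b hb
    have hb := (Finset.mem_Ioo.1 (Finset.mem_coe.1 hb)).2.le
    simp [add_tsub_cancel_of_le hb]
  · rintro ⟨b, c⟩ hbc hn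
    rw [Finset.HasAntidiagonal.mem_antidiagonal] at hbc
    dsimp only at hbc ⊢
    by_cases hb : b = 0
    · rw [hb, uHat_zero, zero_mul]
    by_cases hc : c = 0
    · rw [hc, uHat_zero, mul_zero]
    refine absurd ⟨b, Finset.mem_coe.2 (Finset.mem_Ioo.2 ⟨pos_iff_ne_zero.2 hb, ?_⟩), ?_⟩ hn
    · rw [← hbc]
      exact lt_add_of_pos_right b (pos_iff_ne_zero.2 hc)
    · simp [← hbc]
  · intro b _
    rfl

/-- The multi-indices of degree at most `N`. -/
def degreeLE (N : ℕ) : Finset MultiIndexPair :=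
  (Finset.Iic ((N, N), (N, N))).filter fun a => degree a ≤ N

theorem mem_degreeLE {N : ℕ} {a : MultiIndexPair} : a ∈ degreeLE N ↔ degree a ≤ N := by
  rw [degreeLE, Finset.mem_filter, Finset.mem_Iic]
  exact ⟨fun h => h.2, fun h => ⟨le_of_degree_le h, h⟩⟩

/-- Both parts of a splitting are nonzero, so each has degree at most `N`; distinct splittings yield
distinct terms of the squared sum. -/
theorem sum_convolution_le {f : MultiIndexPair → ℝ} (hf : ∀ a, 0 ≤ f a) (N : ℕ) :
    ∑ a ∈ degreeLE (N + 1), ∑ b ∈ Finset.Ioo 0 a, f b * f (a - b) ≤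
      (∑ a ∈ degreeLE N, f a) ^ 2 := by
  rw [Finset.sum_sigma', sq, Finset.sum_mul_sum, ← Finset.sum_product']
  have hinj : Set.InjOn
      (fun x : (_ : MultiIndexPair) × MultiIndexPair => (x.2, x.1 - x.2))
      ((degreeLE (N + 1)).sigma fun a => Finset.Ioo 0 a) := by
    rintro ⟨a, b⟩ hab ⟨a', b'⟩ hab' h
    have hb := (Finset.mem_Ioo.1 (Finset.mem_sigma.1 (Finset.mem_coe.1 hab)).2).2.le
    have hb' := (Finset.mem_Ioo.1 (Finset.mem_sigma.1 (Finset.mem_coe.1 hab')).2).2.le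
    dsimp only at hb hb' h
    obtain ⟨h1, h2⟩ := Prod.mk.inj h
    subst h1
    rw [← add_tsub_cancel_of_le hb, h2, add_tsub_cancel_of_le hb']
  rw [← Finset.sum_image (f := fun y => f y.1 * f y.2) hinj]
  refine Finset.sum_le_sum_of_subset_of_nonneg ?_ fun y _ _ => mul_nonneg (hf _) (hf _)
  rintro ⟨b, c⟩ hbc
  obtain ⟨⟨a, b'⟩, h, h'⟩ := Finset.mem_image.1 hbc
  obtain ⟨h1, h2⟩ := Finset.mem_sigma.1 h
  obtain ⟨h3, h4⟩ := Finset.mem_Ioo.1 h2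
  obtain ⟨rfl, rfl⟩ := Prod.mk.inj h'
  have ha := mem_degreeLE.1 h1
  have := degree_lt h4
  have := degree_sub_lt h3 h4
  dsimp only at *
  rw [Finset.mem_product, mem_degreeLE, mem_degreeLE]
  exact ⟨by dsimp only; omega, by dsimp only; omega⟩

variable {k₁ k₂ l}

theorem abs_uHat_le {K : ℝ} (hl : ∀ n, |l n| ≤ K) {t : ℝ} (ht : 0 ≤ t) (a : MultiIndexPair) :
    |uHat k₁ k₂ l a| * t ^ degree a ≤ (if degree a = 1 then t / 2 else 0) +
      K * ∑ b ∈ Finset.Ioo 0 a, (|uHat k₁ k₂ l b| * t ^ degree b) *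
        (|uHat k₁ k₂ l (a - b)| * t ^ degree (a - b)) := by
  have hK : 0 ≤ K := (abs_nonneg _).trans (hl 0)
  have hsum : |uSqHat k₁ k₂ l a| * t ^ degree a ≤
      ∑ b ∈ Finset.Ioo 0 a, (|uHat k₁ k₂ l b| * t ^ degree b) *
        (|uHat k₁ k₂ l (a - b)| * t ^ degree (a - b)) := by
    rw [uSqHat]
    refine (mul_le_mul_of_nonneg_right (Finset.abs_sum_le_sum_abs _ _) (by positivity)).trans ?_
    rw [Finset.sum_mul]
    refine (Finset.sum_congr rfl fun b hb => ?_).le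
    have hb := (Finset.mem_Ioo.1 hb).2.le
    rw [abs_mul, ← add_tsub_cancel_of_le hb, degree_add, pow_add, add_tsub_cancel_left]
    ring
  rw [uHat_eq]
  split_ifs with h
  · rw [h, abs_of_pos (by norm_num : (0 : ℝ) < 1 / 2), pow_one]
    have : 0 ≤ K * ∑ b ∈ Finset.Ioo 0 a, (|uHat k₁ k₂ l b| * t ^ degree b) *
        (|uHat k₁ k₂ l (a - b)| * t ^ degree (a - b)) := by positivity
    linarith
  · rw [zero_add, abs_mul, mul_assoc]
    exact mul_le_mul (hl _) hsum (by positivity) hK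

/-- Majorant induction `S (N+1) ≤ 2t + K (S N)²`: the four indices of degree one give `2t`, and `S N
≤ 4t` with `8Kt ≤ 1` bounds the quadratic term by `2t`. -/
theorem sum_degreeLE_le {K : ℝ} (hl : ∀ n, |l n| ≤ K) {t : ℝ} (ht : 0 ≤ t) (hKt : 8 * K * t ≤ 1)
    (N : ℕ) : ∑ a ∈ degreeLE N, |uHat k₁ k₂ l a| * t ^ degree a ≤ 4 * t := by
  have hK : 0 ≤ K := (abs_nonneg _).trans (hl 0)
  induction N with
  | zero =>
    refine (Finset.sum_nonpos fun a ha => ?_).trans (by positivity)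
    rw [degree_eq_zero (Nat.le_zero.1 (mem_degreeLE.1 ha)), uHat_zero]
    simp
  | succ N ih =>
    refine (Finset.sum_le_sum fun a _ => abs_uHat_le hl ht a).trans ?_
    rw [Finset.sum_add_distrib, ← Finset.mul_sum]
    have h1 : ∑ a ∈ degreeLE (N + 1), (if degree a = 1 then t / 2 else 0) ≤ 2 * t := by
      rw [← Finset.sum_filter, Finset.sum_const, nsmul_eq_mul]
      have hc : ((degreeLE (N + 1)).filter fun a => degree a = 1).card ≤ 4 := by
        refine (Finset.card_le_card (t := {((1, 0), (0, 0)), ((0, 1), (0, 0)), ((0, 0), (1, 0)),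
          ((0, 0), (0, 1))}) fun a ha => ?_).trans Finset.card_le_four
        have := eq_of_degree_eq_one (Finset.mem_filter.1 ha).2
        simpa using this
      have hc' : (((degreeLE (N + 1)).filter fun a => degree a = 1).card : ℝ) ≤ 4 := by
        exact_mod_cast hc
      nlinarith
    have h2 := sum_convolution_le (f := fun a => |uHat k₁ k₂ l a| * t ^ degree a)
      (fun a => by positivity) N
    have h3 : (∑ a ∈ degreeLE N, |uHat k₁ k₂ l a| * t ^ degree a) ^ 2 ≤ (4 * t) ^ 2 := by
      gcongr
    have h4 := mul_le_mul_of_nonneg_left (h2.trans h3) hK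
    nlinarith

theorem sum_uHat_le {K : ℝ} (hl : ∀ n, |l n| ≤ K) {t : ℝ} (ht : 0 ≤ t) (hKt : 8 * K * t ≤ 1)
    (s : Finset MultiIndexPair) : ∑ a ∈ s, |uHat k₁ k₂ l a| * t ^ degree a ≤ 4 * t := by
  refine le_trans ?_ (sum_degreeLE_le (k₁ := k₁) (k₂ := k₂) hl ht hKt (s.sup degree))
  exact Finset.sum_le_sum_of_subset_of_nonneg
    (fun a ha => mem_degreeLE.2 (Finset.le_sup ha)) fun a _ _ => by positivity

theorem summable_uHat {K : ℝ} (hl : ∀ n, |l n| ≤ K) {t : ℝ} (ht : 0 ≤ t) (hKt : 8 * K * t ≤ 1) :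
    Summable fun a => |uHat k₁ k₂ l a| * t ^ degree a :=
  summable_of_sum_le (fun a => by positivity) (sum_uHat_le hl ht hKt)

theorem tsum_uHat_le {K : ℝ} (hl : ∀ n, |l n| ≤ K) {t : ℝ} (ht : 0 ≤ t) (hKt : 8 * K * t ≤ 1) :
    ∑' a, |uHat k₁ k₂ l a| * t ^ degree a ≤ 4 * t :=
  (summable_uHat hl ht hKt).tsum_le_of_sum_le (sum_uHat_le hl ht hKt)

theorem abs_uSqHat_le (t : ℝ) (ht : 0 ≤ t) (a : MultiIndexPair) :
    |uSqHat k₁ k₂ l a| * t ^ degree a ≤ ∑ b ∈ Finset.HasAntidiagonal.antidiagonal a,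
      (|uHat k₁ k₂ l b.1| * t ^ degree b.1) * (|uHat k₁ k₂ l b.2| * t ^ degree b.2) := by
  rw [uSqHat_eq_sum_antidiagonal]
  refine (mul_le_mul_of_nonneg_right (Finset.abs_sum_le_sum_abs _ _) (by positivity)).trans ?_
  rw [Finset.sum_mul]
  refine (Finset.sum_congr rfl fun b hb => ?_).le
  rw [← Finset.HasAntidiagonal.mem_antidiagonal.1 hb, abs_mul, degree_add, pow_add]
  ring

theorem summable_uHat_mul_uHat {K : ℝ} (hl : ∀ n, |l n| ≤ K) {t : ℝ} (ht : 0 ≤ t)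
    (hKt : 8 * K * t ≤ 1) : Summable fun b : MultiIndexPair × MultiIndexPair =>
      (|uHat k₁ k₂ l b.1| * t ^ degree b.1) * (|uHat k₁ k₂ l b.2| * t ^ degree b.2) := by
  have h := summable_uHat (k₁ := k₁) (k₂ := k₂) hl ht hKt
  have h0 : 0 ≤ fun a => |uHat k₁ k₂ l a| * t ^ degree a := fun a => by
    simp only [Pi.zero_apply]
    positivity
  exact h.mul_of_nonneg h h0 h0

theorem summable_uSqHat {K : ℝ} (hl : ∀ n, |l n| ≤ K) {t : ℝ} (ht : 0 ≤ t)
    (hKt : 8 * K * t ≤ 1) : Summable fun a => |uSqHat k₁ k₂ l a| * t ^ degree a := by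
  have h := summable_sum_mul_antidiagonal_of_summable_mul
    (f := fun a => |uHat k₁ k₂ l a| * t ^ degree a) (g := fun a => |uHat k₁ k₂ l a| * t ^ degree a)
    (summable_uHat_mul_uHat hl ht hKt)
  exact h.of_nonneg_of_le (fun a => by positivity) (fun a => abs_uSqHat_le t ht a)

theorem tsum_uSqHat_le {K : ℝ} (hl : ∀ n, |l n| ≤ K) {t : ℝ} (ht : 0 ≤ t)
    (hKt : 8 * K * t ≤ 1) : ∑' a, |uSqHat k₁ k₂ l a| * t ^ degree a ≤ (4 * t) ^ 2 := by
  have h := summable_uHat (k₁ := k₁) (k₂ := k₂) hl ht hKt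
  have hm := summable_uHat_mul_uHat (k₁ := k₁) (k₂ := k₂) hl ht hKt
  have hm' := summable_sum_mul_antidiagonal_of_summable_mul
    (f := fun a => |uHat k₁ k₂ l a| * t ^ degree a) (g := fun a => |uHat k₁ k₂ l a| * t ^ degree a)
    hm
  have h1 := (summable_uSqHat (k₁ := k₁) (k₂ := k₂) hl ht hKt).tsum_le_tsum
    (fun a => abs_uSqHat_le t ht a) hm'
  have h2 := h.tsum_mul_tsum_eq_tsum_sum_antidiagonal h hm
  refine h1.trans ?_
  rw [← h2, ← sq]
  have := tsum_uHat_le (k₁ := k₁) (k₂ := k₂) hl ht hKt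
  have h0 : 0 ≤ ∑' a, |uHat k₁ k₂ l a| * t ^ degree a := tsum_nonneg fun a => by positivity
  gcongr

end coefficients

end CapillaryWhitham

/-! ### Absolutely convergent exponential series and the expansion. -/

namespace CapillaryWhitham

open MeasureTheory Real ComplexConjugate

/-- The exponential `e^{inx}`. -/
noncomputable def expMode (n : ℤ) (x : ℝ) : ℂ := Complex.exp (n * x * Complex.I)

theorem expMode_add (m n : ℤ) (x : ℝ) : expMode (m + n) x = expMode m x * expMode n x := by
  rw [expMode, expMode, expMode, ← Complex.exp_add]
  push_cast
  ring_nf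

theorem norm_expMode (n : ℤ) (x : ℝ) : ‖expMode n x‖ = 1 := by
  rw [expMode, show (n * x * Complex.I : ℂ) = ((n * x : ℝ) : ℂ) * Complex.I by push_cast; ring]
  exact Complex.norm_exp_ofReal_mul_I _

theorem continuous_expMode (n : ℤ) : Continuous (expMode n) := by
  unfold expMode
  fun_prop

theorem expMode_zero (x : ℝ) : expMode 0 x = 1 := by simp [expMode]

theorem expMode_add_two_pi (n : ℤ) (x : ℝ) : expMode n (x + 2 * π) = expMode n x := by
  rw [expMode, expMode]
  have : (n * ((x + 2 * π : ℝ) : ℂ) * Complex.I : ℂ) =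
      n * x * Complex.I + n * (2 * π * Complex.I) := by push_cast; ring
  rw [this, Complex.exp_add, Complex.exp_int_mul_two_pi_mul_I, mul_one]

theorem expMode_sum (n : ℤ) (x y : ℝ) : expMode n (x + y) = expMode n x * expMode n y := by
  rw [expMode, expMode, expMode, ← Complex.exp_add]
  push_cast
  ring_nf

theorem integral_expMode (n : ℤ) :
    ∫ x in (0 : ℝ)..2 * π, expMode n x = if n = 0 then 2 * (π : ℂ) else 0 := by
  split_ifs with h
  · simp [h, expMode_zero]
  · have hc : (n * Complex.I : ℂ) ≠ 0 := mul_ne_zero (by exact_mod_cast h) Complex.I_ne_zero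
    have := integral_exp_mul_complex (a := 0) (b := 2 * π) hc
    have he : ∀ x : ℝ, expMode n x = Complex.exp (n * Complex.I * x) := fun x => by
      rw [expMode]
      ring_nf
    simp_rw [he]
    rw [this, show (n * Complex.I * (2 * π : ℝ) : ℂ) = n * (2 * π * Complex.I) by push_cast; ring,
      Complex.exp_int_mul_two_pi_mul_I]
    simp

theorem fourierCoeffOn_eq_integral_expMode (f : ℝ → ℂ) (n : ℤ) :
    fourierCoeffOn Real.two_pi_pos f n =
      (2 * (π : ℂ))⁻¹ * ∫ x in (0 : ℝ)..2 * π, expMode (-n) x * f x := by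
  rw [fourierCoeffOn_eq_integral, Complex.real_smul]
  congr 1
  · simp
  · refine intervalIntegral.integral_congr fun x _ => ?_
    simp only [smul_eq_mul, fourier_coe_apply, expMode]
    congr 2
    have : (π : ℂ) ≠ 0 := by exact_mod_cast Real.pi_ne_zero
    push_cast
    field_simp
    ring

section series

variable {ι : Type*} {c : ι → ℂ} {ω : ι → ℤ} (hc : Summable fun i => ‖c i‖)

include hc

/-- Termwise integration. Several indices may share a frequency, so a coefficient is itself a
series. -/
theorem hasSum_fourierCoeffOn_tsum [Countable ι] (n : ℤ) :
    HasSum (fun i => if ω i = n then c i else 0)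
      (fourierCoeffOn Real.two_pi_pos (fun x => ∑' i, c i * expMode (ω i) x) n) := by
  rw [fourierCoeffOn_eq_integral_expMode]
  have h := intervalIntegral.hasSum_integral_of_dominated_convergence (μ := volume)
    (a := (0 : ℝ)) (b := 2 * π) (F := fun i x => c i * expMode (ω i - n) x)
    (f := fun x => expMode (-n) x * ∑' i, c i * expMode (ω i) x) (fun i _ => ‖c i‖)
    (fun i => ((continuous_expMode _).const_mul (c i)).aestronglyMeasurable)
    (fun i => .of_forall fun x _ => by rw [norm_mul, norm_expMode, mul_one])
    (.of_forall fun x _ => hc) intervalIntegrable_const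
    (.of_forall fun x _ => by
      have hs : Summable fun i => c i * expMode (ω i) x :=
        .of_norm (by simpa only [norm_mul, norm_expMode, mul_one] using hc)
      refine (hs.hasSum.mul_left (expMode (-n) x)).congr_fun fun i => ?_
      rw [sub_eq_add_neg, expMode_add]
      ring)
  refine (h.mul_left (2 * (π : ℂ))⁻¹).congr_fun fun i => ?_
  rw [intervalIntegral.integral_const_mul, integral_expMode]
  have : (π : ℂ) ≠ 0 := by exact_mod_cast Real.pi_ne_zero
  simp only [sub_eq_zero]
  split_ifs
  · field_simp
  · simp

theorem continuous_tsum_expMode : Continuous fun x => ∑' i, c i * expMode (ω i) x :=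
  continuous_tsum (fun i => (continuous_expMode _).const_mul (c i)) hc
    fun i x => by rw [norm_mul, norm_expMode, mul_one]

theorem norm_tsum_expMode_le (x : ℝ) : ‖∑' i, c i * expMode (ω i) x‖ ≤ ∑' i, ‖c i‖ := by
  refine (norm_tsum_le_tsum_norm ?_).trans_eq ?_
  all_goals simp only [norm_mul, norm_expMode, mul_one]
  exact hc

end series

/-- The monomial `(2 z)^α (2 z̄)^β`. -/
noncomputable def coeffMonomial (z₁ z₂ : ℂ) (a : MultiIndexPair) : ℂ :=
  (2 * z₁) ^ a.1.1 * (2 * z₂) ^ a.1.2 * ((2 * conj z₁) ^ a.2.1 * (2 * conj z₂) ^ a.2.2)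

theorem coeffMonomial_add (z₁ z₂ : ℂ) (a b : MultiIndexPair) :
    coeffMonomial z₁ z₂ (a + b) = coeffMonomial z₁ z₂ a * coeffMonomial z₁ z₂ b := by
  simp only [coeffMonomial, Prod.fst_add, Prod.snd_add, pow_add]
  ring

theorem norm_coeffMonomial (z₁ z₂ : ℂ) (a : MultiIndexPair) :
    ‖coeffMonomial z₁ z₂ a‖ =
      2 ^ degree a * (‖z₁‖ ^ (a.1.1 + a.2.1) * ‖z₂‖ ^ (a.1.2 + a.2.2)) := by
  simp only [coeffMonomial, norm_mul, norm_pow, RCLike.norm_conj, RCLike.norm_ofNat, mul_pow,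
    degree, pow_add]
  ring

theorem norm_coeffMonomial_le {z₁ z₂ : ℂ} {ρ : ℝ} (h₁ : ‖z₁‖ ≤ ρ) (h₂ : ‖z₂‖ ≤ ρ)
    (a : MultiIndexPair) : ‖coeffMonomial z₁ z₂ a‖ ≤ (2 * ρ) ^ degree a := by
  have hρ : 0 ≤ ρ := (norm_nonneg _).trans h₁
  rw [norm_coeffMonomial, mul_pow]
  gcongr
  calc ‖z₁‖ ^ (a.1.1 + a.2.1) * ‖z₂‖ ^ (a.1.2 + a.2.2)
      ≤ ρ ^ (a.1.1 + a.2.1) * ρ ^ (a.1.2 + a.2.2) := by gcongr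
    _ = ρ ^ degree a := by
      rw [← pow_add]
      congr 1
      simp only [degree]
      omega

section expansion

variable (k₁ k₂ : ℕ) (l : ℤ → ℝ) (z₁ z₂ : ℂ)

/-- The function with Taylor--Fourier coefficients `uHat` and Fourier coefficients `z₁`, `z₂` at
`k₁`, `k₂`. -/
noncomputable def expansion (x : ℝ) : ℂ :=
  ∑' a, ((uHat k₁ k₂ l a : ℂ) * coeffMonomial z₁ z₂ a) * expMode (frequency k₁ k₂ a) x

variable {k₁ k₂ l z₁ z₂}
variable {K ρ : ℝ} (hl : ∀ n, |l n| ≤ K) (hK : 16 * K * ρ ≤ 1) (h₁ : ‖z₁‖ ≤ ρ) (h₂ : ‖z₂‖ ≤ ρ)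

include h₁ h₂ in
theorem norm_ofReal_mul_coeffMonomial_le (s : ℝ) (a : MultiIndexPair) :
    ‖(s : ℂ) * coeffMonomial z₁ z₂ a‖ ≤ |s| * (2 * ρ) ^ degree a := by
  rw [norm_mul, Complex.norm_real, norm_eq_abs]
  gcongr
  exact norm_coeffMonomial_le h₁ h₂ a

include hl hK h₁ h₂

theorem summable_norm_uHat_mul :
    Summable fun a => ‖(uHat k₁ k₂ l a : ℂ) * coeffMonomial z₁ z₂ a‖ :=
  (summable_uHat hl (t := 2 * ρ) (by linarith [norm_nonneg z₁]) (by linarith)).of_nonneg_of_le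
    (fun a => norm_nonneg _) fun a => norm_ofReal_mul_coeffMonomial_le h₁ h₂ _ a

theorem summable_norm_uSqHat_mul :
    Summable fun a => ‖(uSqHat k₁ k₂ l a : ℂ) * coeffMonomial z₁ z₂ a‖ :=
  (summable_uSqHat hl (t := 2 * ρ) (by linarith [norm_nonneg z₁]) (by linarith)).of_nonneg_of_le
    (fun a => norm_nonneg _) fun a => norm_ofReal_mul_coeffMonomial_le h₁ h₂ _ a

theorem norm_expansion_le (x : ℝ) : ‖expansion k₁ k₂ l z₁ z₂ x‖ ≤ 8 * ρ := by
  have hρ : 0 ≤ 2 * ρ := by linarith [norm_nonneg z₁]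
  have hs := summable_uHat (k₁ := k₁) (k₂ := k₂) hl (t := 2 * ρ) hρ (by linarith)
  have hs' := summable_norm_uHat_mul (k₁ := k₁) (k₂ := k₂) hl hK h₁ h₂
  refine (norm_tsum_expMode_le hs' x).trans
    ((hs'.tsum_le_tsum (fun a => norm_ofReal_mul_coeffMonomial_le h₁ h₂ _ a) hs).trans ?_)
  have := tsum_uHat_le (k₁ := k₁) (k₂ := k₂) hl (t := 2 * ρ) hρ (by linarith)
  linarith

theorem continuous_expansion : Continuous (expansion k₁ k₂ l z₁ z₂) :=
  continuous_tsum_expMode (summable_norm_uHat_mul hl hK h₁ h₂)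

theorem expansion_sq (x : ℝ) : expansion k₁ k₂ l z₁ z₂ x ^ 2 =
    ∑' a, ((uSqHat k₁ k₂ l a : ℂ) * coeffMonomial z₁ z₂ a) * expMode (frequency k₁ k₂ a) x := by
  set f : MultiIndexPair → ℂ := fun a =>
    ((uHat k₁ k₂ l a : ℂ) * coeffMonomial z₁ z₂ a) * expMode (frequency k₁ k₂ a) x with hf
  have hs : Summable fun a => ‖f a‖ := by
    simpa only [hf, norm_mul, norm_expMode, mul_one] using
      summable_norm_uHat_mul (k₁ := k₁) (k₂ := k₂) hl hK h₁ h₂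
  have hfs : Summable f := hs.of_norm
  have hm : Summable fun b : MultiIndexPair × MultiIndexPair => f b.1 * f b.2 :=
    summable_mul_of_summable_norm hs hs
  have h := hfs.tsum_mul_tsum_eq_tsum_sum_antidiagonal hfs hm
  rw [expansion, sq, h]
  refine tsum_congr fun a => ?_
  rw [uSqHat_eq_sum_antidiagonal]
  push_cast
  rw [Finset.sum_mul, Finset.sum_mul]
  refine Finset.sum_congr rfl fun b hb => ?_
  rw [← Finset.HasAntidiagonal.mem_antidiagonal.1 hb, coeffMonomial_add, frequency_add, expMode_add]
  simp only [hf]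
  ring

theorem hasSum_fourierCoeffOn_expansion (n : ℤ) :
    HasSum (fun a => if frequency k₁ k₂ a = n then
        (uHat k₁ k₂ l a : ℂ) * coeffMonomial z₁ z₂ a else 0)
      (fourierCoeffOn Real.two_pi_pos (expansion k₁ k₂ l z₁ z₂) n) :=
  hasSum_fourierCoeffOn_tsum (summable_norm_uHat_mul hl hK h₁ h₂) n

theorem hasSum_fourierCoeffOn_expansion_sq (n : ℤ) :
    HasSum (fun a => if frequency k₁ k₂ a = n then
        (uSqHat k₁ k₂ l a : ℂ) * coeffMonomial z₁ z₂ a else 0)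
      (fourierCoeffOn Real.two_pi_pos (fun x => expansion k₁ k₂ l z₁ z₂ x ^ 2) n) := by
  have := hasSum_fourierCoeffOn_tsum (ω := frequency k₁ k₂)
    (summable_norm_uSqHat_mul (k₁ := k₁) (k₂ := k₂) hl hK h₁ h₂) n
  simpa only [expansion_sq hl hK h₁ h₂] using this

/-- Other indices with the same frequency have higher degree (or degree zero) and are killed by `l =
0` there. Hence `z₁`, `z₂` really are the kernel coefficients. -/
theorem fourierCoeffOn_expansion_of_degree_eq_one (hk₁ : 1 ≤ k₁) (hk : k₁ < k₂)
    (hl0 : ∀ n : ℤ, n.natAbs = k₁ ∨ n.natAbs = k₂ → l n = 0) {a : MultiIndexPair}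
    (ha : degree a = 1) :
    fourierCoeffOn Real.two_pi_pos (expansion k₁ k₂ l z₁ z₂) (frequency k₁ k₂ a) =
      1 / 2 * coeffMonomial z₁ z₂ a := by
  have h := hasSum_fourierCoeffOn_expansion (k₁ := k₁) (k₂ := k₂) hl hK h₁ h₂ (frequency k₁ k₂ a)
  refine h.unique ?_
  convert hasSum_single a fun b hb => ?_ using 1
  · rw [if_pos rfl, uHat_eq, if_pos ha]
    push_cast
    rfl
  · by_cases hf : frequency k₁ k₂ b = frequency k₁ k₂ a
    · have hb1 : degree b ≠ 1 := by
        intro hb1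
        apply hb
        rcases eq_of_degree_eq_one ha with rfl | rfl | rfl | rfl <;>
        rcases eq_of_degree_eq_one hb1 with rfl | rfl | rfl | rfl <;>
        simp only [frequency] at hf <;> first | rfl | (exfalso; push_cast at hf; omega)
      have hlz : l (frequency k₁ k₂ b) = 0 := by
        apply hl0
        rw [hf]
        rcases eq_of_degree_eq_one ha with rfl | rfl | rfl | rfl <;> simp [frequency]
      rw [if_pos hf, uHat_eq, if_neg hb1, hlz]
      simp
    · rw [if_neg hf]

/-- Degree-one indices sit at `±k₁`, `±k₂`, so at this frequency only the recursive branch of `uHat`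
occurs. -/
theorem fourierCoeffOn_expansion_of_ne {n : ℤ} (hn₁ : n.natAbs ≠ k₁) (hn₂ : n.natAbs ≠ k₂) :
    fourierCoeffOn Real.two_pi_pos (expansion k₁ k₂ l z₁ z₂) n =
      l n * fourierCoeffOn Real.two_pi_pos (fun x => expansion k₁ k₂ l z₁ z₂ x ^ 2) n := by
  refine (hasSum_fourierCoeffOn_expansion hl hK h₁ h₂ n).unique ?_
  refine ((hasSum_fourierCoeffOn_expansion_sq hl hK h₁ h₂ n).mul_left (l n : ℂ)).congr_fun
    fun a => ?_
  split_ifs with hf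
  · have ha : degree a ≠ 1 := by
      intro ha
      rcases eq_of_degree_eq_one ha with rfl | rfl | rfl | rfl <;>
      simp [frequency] at hf <;> omega
    rw [uHat_eq, if_neg ha, hf]
    push_cast
    ring
  · simp

end expansion

theorem expansion_add_two_pi (k₁ k₂ : ℕ) (l : ℤ → ℝ) (z₁ z₂ : ℂ) :
    Function.Periodic (expansion k₁ k₂ l z₁ z₂) (2 * π) := fun x => by
  simp only [expansion, expMode_add_two_pi]

end CapillaryWhitham

/-! ### Small solutions coincide with the expansion. -/

namespace CapillaryWhitham

open MeasureTheory Real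

theorem ae_eq_zero_of_periodic {g : ℝ → ℂ} {p : ℝ} (hp : 0 < p) (hg : Function.Periodic g p)
    (h : ∀ᵐ x ∂volume.restrict (Set.Ioc 0 p), g x = 0) : ∀ᵐ x : ℝ, g x = 0 := by
  have hd := isAddFundamentalDomain_Ioc hp 0 (volume : Measure ℝ)
  rw [zero_add] at hd
  rw [ae_iff] at h ⊢
  refine hd.measure_zero_of_invariant _ ?_ ?_
  · rintro ⟨-, n, rfl⟩
    ext x
    rw [Set.mem_vadd_set_iff_neg_vadd_mem]
    have := hg.sub_zsmul_eq (x := x) n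
    simp only [Set.mem_ofPred_eq, AddSubgroup.vadd_def, vadd_eq_add, NegMemClass.coe_neg]
    rw [← this, sub_eq_neg_add]
  · rwa [Measure.restrict_apply₀' measurableSet_Ioc.nullMeasurableSet] at h

/-- By Parseval, `‖g‖ ≤ K ‖h g‖ ≤ K M ‖g‖` in L² of a period, and `K M < 1`. -/
theorem ae_eq_zero_of_fourierCoeffOn_le {g h : ℝ → ℂ} {K M : ℝ}
    (hper : Function.Periodic g (2 * π)) (hg : MemLp g ⊤ volume)
    (hh : AEStronglyMeasurable h volume) (hM : ∀ᵐ x, ‖h x‖ ≤ M) (hM0 : 0 ≤ M) (hK : 0 ≤ K)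
    (hKM : K * M < 1) (hle : ∀ n : ℤ, ‖fourierCoeffOn Real.two_pi_pos g n‖ ≤
      K * ‖fourierCoeffOn Real.two_pi_pos (fun x => h x * g x) n‖) : ∀ᵐ x : ℝ, g x = 0 := by
  have hhg : MemLp (fun x => h x * g x) ⊤ volume :=
    hg.mul (r := ⊤) (p := ⊤) (memLp_top_of_bound hh M hM)
  have hg2 : MemLp g 2 (volume.restrict (Set.Ioc 0 (2 * π))) :=
    (hg.restrict _).mono_exponent le_top
  have hhg2 : MemLp (fun x => h x * g x) 2 (volume.restrict (Set.Ioc 0 (2 * π))) :=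
    (hhg.restrict _).mono_exponent le_top
  have hs := hasSum_sq_fourierCoeffOn Real.two_pi_pos hg2
  have hs' := hasSum_sq_fourierCoeffOn Real.two_pi_pos hhg2
  have h1 := hasSum_le (fun n => by
    have := pow_le_pow_left₀ (norm_nonneg _) (hle n) 2
    rwa [mul_pow] at this) hs (hs'.mul_left (K ^ 2))
  rw [smul_eq_mul, smul_eq_mul, mul_left_comm] at h1
  have hpi : (0 : ℝ) < (2 * π - 0)⁻¹ := by rw [sub_zero]; positivity
  have h2 := le_of_mul_le_mul_left h1 hpi
  rw [intervalIntegral.integral_of_le Real.two_pi_pos.le,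
    intervalIntegral.integral_of_le Real.two_pi_pos.le] at h2
  have hig := hg2.integrable_norm_pow two_ne_zero
  have hihg := hhg2.integrable_norm_pow two_ne_zero
  have h3 : ∫ x in Set.Ioc 0 (2 * π), ‖h x * g x‖ ^ 2 ≤
      ∫ x in Set.Ioc 0 (2 * π), M ^ 2 * ‖g x‖ ^ 2 := by
    refine integral_mono_ae hihg (hig.const_mul _) ?_
    filter_upwards [ae_restrict_of_ae hM] with x hx
    rw [norm_mul, mul_pow]
    gcongr
  rw [integral_const_mul] at h3
  set I := ∫ x in Set.Ioc 0 (2 * π), ‖g x‖ ^ 2 with hI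
  have hI0 : 0 ≤ I := integral_nonneg fun x => by positivity
  have hIz : I = 0 := by
    have h4 := mul_le_mul_of_nonneg_left h3 (sq_nonneg K)
    have h5 : I ≤ (K * M) ^ 2 * I := by linarith
    have h6 : (K * M) ^ 2 < 1 := by
      have : 0 ≤ K * M := by positivity
      exact pow_lt_one₀ this hKM two_ne_zero
    nlinarith
  refine ae_eq_zero_of_periodic Real.two_pi_pos hper ?_
  have := (integral_eq_zero_iff_of_nonneg (fun x => by simp only [Pi.zero_apply]; positivity)
    hig).1 hIz
  filter_upwards [this] with x hx
  simpa using hx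

theorem fourierCoeffOn_sub {f g : ℝ → ℂ} (hf : MemLp f ⊤ volume) (hg : MemLp g ⊤ volume) (n : ℤ) :
    fourierCoeffOn Real.two_pi_pos (fun x => f x - g x) n =
      fourierCoeffOn Real.two_pi_pos f n - fourierCoeffOn Real.two_pi_pos g n := by
  have hi : ∀ f : ℝ → ℂ, MemLp f ⊤ volume →
      IntervalIntegrable (fun x => expMode (-n) x * f x) volume 0 (2 * π) := fun f hf => by
    have he : MemLp (expMode (-n)) ⊤ volume :=
      memLp_top_of_bound (continuous_expMode _).aestronglyMeasurable 1
        (.of_forall fun x => (norm_expMode _ x).le)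
    rw [intervalIntegrable_iff, Set.uIoc_of_le Real.two_pi_pos.le]
    exact memLp_one_iff_integrable.1 (((hf.mul (r := ⊤) he).restrict _).mono_exponent le_top)
  simp only [fourierCoeffOn_eq_integral_expMode, mul_sub]
  rw [intervalIntegral.integral_sub (hi f hf) (hi g hg), mul_sub]

theorem fourierHat_neg (u : ℝ → ℝ) (n : ℤ) :
    fourierHat u (-n) = starRingEnd ℂ (fourierHat u n) := by
  rw [fourierHat, fourierHat, fourierCoeffOn_eq_integral_expMode,
    fourierCoeffOn_eq_integral_expMode, map_mul, intervalIntegral.integral_of_le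
    Real.two_pi_pos.le, intervalIntegral.integral_of_le Real.two_pi_pos.le, ← integral_conj]
  congr 1
  · rw [map_inv₀, map_mul, Complex.conj_ofReal, Complex.conj_ofNat]
  · refine integral_congr_ae (.of_forall fun x => ?_)
    simp only [map_mul, Complex.conj_ofReal, expMode, ← Complex.exp_conj, Complex.conj_I,
      map_intCast]
    push_cast
    ring_nf

theorem norm_fourierHat_le {u : ℝ → ℝ} {ρ : ℝ} (hu : ∀ᵐ x, |u x| ≤ ρ) (n : ℤ) :
    ‖fourierHat u n‖ ≤ ρ := by
  have h := intervalIntegral.norm_integral_le_of_norm_le_const_ae (a := 0) (b := 2 * π)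
    (f := fun x => expMode (-n) x * (u x : ℂ)) (C := ρ) (by
      filter_upwards [hu] with x hx _
      rwa [norm_mul, norm_expMode, one_mul, Complex.norm_real])
  rw [fourierHat, fourierCoeffOn_eq_integral_expMode, norm_mul]
  have hpi := Real.two_pi_pos
  rw [sub_zero, abs_of_pos hpi] at h
  have h1 : ‖(2 * (π : ℂ))⁻¹‖ = (2 * π)⁻¹ := by
    rw [norm_inv, norm_mul, Complex.norm_real, norm_of_nonneg Real.pi_pos.le, RCLike.norm_ofNat]
  rw [h1, inv_mul_le_iff₀ hpi]
  linarith

theorem fourierHat_eq {k₁ k₂ : ℕ} {u : ℝ → ℝ} {c κ T : ℝ} (hu : IsSolution u c κ T) {n : ℤ}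
    (hn₁ : n.natAbs ≠ k₁) (hn₂ : n.natAbs ≠ k₂) (hne : symbol T (κ * n) ≠ c) :
    fourierHat u n = ell k₁ k₂ c κ T n * fourierHat (fun x => u x ^ 2) n := by
  have h := hu.eqn n
  have h0 : ((c - symbol T (κ * n) : ℝ) : ℂ) ≠ 0 := by
    exact_mod_cast sub_ne_zero.2 hne.symm
  rw [ell, if_neg (not_or.2 ⟨hn₁, hn₂⟩), Complex.ofReal_inv, eq_inv_mul_iff_mul_eq₀ h0]
  push_cast at h ⊢
  linear_combination -h

/-- Small solutions are given by the expansion. -/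
theorem ae_eq_expansion {k₁ k₂ : ℕ} (hk₁ : 1 ≤ k₁) (hk : k₁ < k₂) {u : ℝ → ℝ} {c κ T K ρ : ℝ}
    (hu : IsSolution u c κ T) (huρ : ∀ᵐ x, |u x| ≤ ρ)
    (hK : ∀ n, |ell k₁ k₂ c κ T n| ≤ K) (hKρ : 16 * K * ρ ≤ 1)
    (hne : ∀ n : ℤ, n.natAbs ≠ k₁ → n.natAbs ≠ k₂ → symbol T (κ * n) ≠ c) :
    (fun x => (u x : ℂ)) =ᵐ[volume]
      expansion k₁ k₂ (ell k₁ k₂ c κ T) (fourierHat u k₁) (fourierHat u k₂) := by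
  have h₁ := norm_fourierHat_le huρ k₁
  have h₂ := norm_fourierHat_le huρ k₂
  have hρ : 0 ≤ ρ := (norm_nonneg _).trans h₁
  have hK0 : 0 ≤ K := (abs_nonneg _).trans (hK 0)
  set l := ell k₁ k₂ c κ T with hl
  set z₁ := fourierHat u k₁ with hz₁
  set z₂ := fourierHat u k₂ with hz₂
  set V := expansion k₁ k₂ l z₁ z₂ with hV
  have hVc : Continuous V := continuous_expansion hK hKρ h₁ h₂
  have hVb : ∀ x, ‖V x‖ ≤ 8 * ρ := norm_expansion_le hK hKρ h₁ h₂
  have hVL : MemLp V ⊤ volume := memLp_top_of_bound hVc.aestronglyMeasurable _ (.of_forall hVb)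
  have hV2L : MemLp (fun x => V x ^ 2) ⊤ volume := by
    simpa only [sq] using! hVL.mul (r := ⊤) hVL
  have huL : MemLp (fun x => (u x : ℂ)) ⊤ volume := hu.memLp.ofReal
  have hu2L : MemLp (fun x => ((u x ^ 2 : ℝ) : ℂ)) ⊤ volume := by
    simpa only [sq, Complex.ofReal_mul] using! huL.mul (r := ⊤) huL
  have hdeg : ∀ a : MultiIndexPair, degree a = 1 →
      fourierCoeffOn Real.two_pi_pos V (frequency k₁ k₂ a) = 1 / 2 * coeffMonomial z₁ z₂ a :=
    fun a ha => fourierCoeffOn_expansion_of_degree_eq_one hK hKρ h₁ h₂ hk₁ hk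
      (fun n hn => if_pos hn) ha
  have hcoef : ∀ n : ℤ, n.natAbs = k₁ ∨ n.natAbs = k₂ →
      fourierCoeffOn Real.two_pi_pos V n = fourierHat u n := by
    intro n hn
    have d1 := hdeg ((1, 0), (0, 0)) rfl
    have d2 := hdeg ((0, 1), (0, 0)) rfl
    have d3 := hdeg ((0, 0), (1, 0)) rfl
    have d4 := hdeg ((0, 0), (0, 1)) rfl
    simp [frequency, coeffMonomial] at d1 d2 d3 d4
    have : n = k₁ ∨ n = k₂ ∨ n = -k₁ ∨ n = -k₂ := by omega
    rcases this with rfl | rfl | rfl | rfl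
    · exact d1
    · exact d2
    · rw [d3, fourierHat_neg]
    · rw [d4, fourierHat_neg]
  -- Contraction for the difference of two solutions, through `u² - V² = (u + V)(u - V)`; `9ρ` is
  -- the bound `ρ + 8ρ` on `u + V`.
  have hz := ae_eq_zero_of_fourierCoeffOn_le (g := fun x => (u x : ℂ) - V x)
    (h := fun x => (u x : ℂ) + V x) (K := K) (M := 9 * ρ)
    (fun x => by
      dsimp only
      rw [hu.periodic x, hV, expansion_add_two_pi k₁ k₂ l z₁ z₂ x])
    (huL.sub hVL) (huL.add hVL).aestronglyMeasurable
    (by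
      filter_upwards [huρ] with x hx
      refine (norm_add_le _ _).trans ?_
      rw [Complex.norm_real, norm_eq_abs]
      linarith [hVb x])
    (by positivity) hK0 (by linarith) (fun n => by
      have hmul : (fun x => ((u x : ℂ) + V x) * ((u x : ℂ) - V x)) =
          fun x => ((u x ^ 2 : ℝ) : ℂ) - V x ^ 2 := by
        funext x
        push_cast
        ring
      rw [hmul, fourierCoeffOn_sub huL hVL, fourierCoeffOn_sub hu2L hV2L]
      change ‖fourierHat u n - _‖ ≤ K * ‖fourierHat (fun x => u x ^ 2) n - _‖
      by_cases hn : n.natAbs = k₁ ∨ n.natAbs = k₂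
      · rw [hcoef n hn, sub_self, norm_zero]
        positivity
      · obtain ⟨hn₁, hn₂⟩ := not_or.1 hn
        rw [fourierHat_eq hu hn₁ hn₂ (hne n hn₁ hn₂),
          fourierCoeffOn_expansion_of_ne hK hKρ h₁ h₂ hn₁ hn₂, ← mul_sub, norm_mul,
          Complex.norm_real, norm_eq_abs]
        gcongr
        exact hK n)
  filter_upwards [hz] with x hx
  exact sub_eq_zero.1 hx

end CapillaryWhitham

/-! ### The resonant equation at frequency `-k₁`. -/

namespace CapillaryWhitham

open MeasureTheory Real ComplexConjugate

theorem abs_sin_nat_mul_le (n : ℕ) (x : ℝ) : |sin (n * x)| ≤ n * |sin x| := by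
  induction n with
  | zero => simp
  | succ n ih =>
    push_cast
    rw [add_mul, one_mul, sin_add]
    refine (abs_add_le _ _).trans ?_
    rw [abs_mul, abs_mul]
    have h1 := mul_le_mul_of_nonneg_left (abs_cos_le_one x) (abs_nonneg (sin (n * x)))
    have h2 := mul_le_mul_of_nonneg_right (abs_cos_le_one (n * x)) (abs_nonneg (sin x))
    linarith

theorem abs_sin_int_mul_le (m : ℤ) (x : ℝ) : |sin (m * x)| ≤ m.natAbs * |sin x| := by
  obtain ⟨n, rfl | rfl⟩ := m.eq_nat_or_neg
  · simpa using abs_sin_nat_mul_le n x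
  · simpa [abs_neg] using abs_sin_nat_mul_le n x

/-- Coprimality leaves one integer parameter `m`, so after multiplication by `z₁` every phase is a
multiple of a single angle. -/
theorem frequency_eq_neg_iff {d p q : ℕ} (hd : 0 < d) (hq : 0 < q) (hpq : Nat.Coprime p q)
    {a : MultiIndexPair} (h : frequency (d * p) (d * q) a = -((d * p : ℕ) : ℤ)) :
    ∃ m : ℤ, (a.1.1 : ℤ) - a.2.1 + 1 = q * m ∧ (a.1.2 : ℤ) - a.2.2 = -(p * m) := by
  have hd' : (d : ℤ) ≠ 0 := by exact_mod_cast hd.ne'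
  have hq' : (q : ℤ) ≠ 0 := by exact_mod_cast hq.ne'
  have h1 : (p : ℤ) * ((a.1.1 : ℤ) - a.2.1 + 1) = q * -((a.1.2 : ℤ) - a.2.2) := by
    apply mul_left_cancel₀ hd'
    simp only [frequency] at h
    push_cast at h
    linear_combination h
  have h2 : (q : ℤ) ∣ (a.1.1 : ℤ) - a.2.1 + 1 :=
    (Nat.isCoprime_iff_coprime.2 hpq.symm).dvd_of_dvd_mul_left (Dvd.intro _ h1.symm)
  obtain ⟨m, hm⟩ := h2
  refine ⟨m, hm, mul_left_cancel₀ hq' ?_⟩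
  rw [hm] at h1
  linear_combination h1

theorem mul_coeffMonomial_eq (z₁ z₂ : ℂ) (a : MultiIndexPair) :
    z₁ * coeffMonomial z₁ z₂ a =
      ((2 ^ degree a * (‖z₁‖ ^ (a.1.1 + a.2.1 + 1) * ‖z₂‖ ^ (a.1.2 + a.2.2)) : ℝ) : ℂ) *
        Complex.exp (((((a.1.1 : ℤ) - a.2.1 + 1 : ℤ) : ℝ) * z₁.arg +
          (((a.1.2 : ℤ) - a.2.2 : ℤ) : ℝ) * z₂.arg : ℝ) * Complex.I) := by
  have e1 := Complex.norm_mul_exp_arg_mul_I z₁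
  have e2 := Complex.norm_mul_exp_arg_mul_I z₂
  have c1 : conj z₁ = ‖z₁‖ * Complex.exp (-(z₁.arg * Complex.I)) := by
    conv_lhs => rw [← e1]
    rw [map_mul, Complex.conj_ofReal, ← Complex.exp_conj, map_mul, Complex.conj_ofReal,
      Complex.conj_I, mul_neg]
  have c2 : conj z₂ = ‖z₂‖ * Complex.exp (-(z₂.arg * Complex.I)) := by
    conv_lhs => rw [← e2]
    rw [map_mul, Complex.conj_ofReal, ← Complex.exp_conj, map_mul, Complex.conj_ofReal,
      Complex.conj_I, mul_neg]
  have hexp : Complex.exp (((((a.1.1 : ℤ) - a.2.1 + 1 : ℤ) : ℝ) * z₁.arg +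
          (((a.1.2 : ℤ) - a.2.2 : ℤ) : ℝ) * z₂.arg : ℝ) * Complex.I) =
      Complex.exp (z₁.arg * Complex.I) * (Complex.exp (z₁.arg * Complex.I) ^ a.1.1 *
        Complex.exp (z₂.arg * Complex.I) ^ a.1.2 *
        (Complex.exp (-(z₁.arg * Complex.I)) ^ a.2.1 *
          Complex.exp (-(z₂.arg * Complex.I)) ^ a.2.2)) := by
    simp only [← Complex.exp_nat_mul, ← Complex.exp_add]
    push_cast
    ring_nf
  rw [hexp, coeffMonomial, c1, c2]
  clear hexp c1 c2
  simp only [mul_pow, degree, pow_add]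
  push_cast
  generalize Complex.exp (z₁.arg * Complex.I) = E₁ at *
  generalize Complex.exp (z₂.arg * Complex.I) = E₂ at *
  generalize Complex.exp (-(z₁.arg * Complex.I)) = F₁ at *
  generalize Complex.exp (-(z₂.arg * Complex.I)) = F₂ at *
  generalize (‖z₁‖ : ℂ) = r₁ at *
  generalize (‖z₂‖ : ℂ) = r₂ at *
  subst e1 e2
  ring

theorem mul_coeffMonomial_im (z₁ z₂ : ℂ) {p q : ℕ} {a : MultiIndexPair} {m : ℤ}
    (h₁ : (a.1.1 : ℤ) - a.2.1 + 1 = q * m) (h₂ : (a.1.2 : ℤ) - a.2.2 = -(p * m)) :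
    (z₁ * coeffMonomial z₁ z₂ a).im =
      2 ^ degree a * (‖z₁‖ ^ (a.1.1 + a.2.1 + 1) * ‖z₂‖ ^ (a.1.2 + a.2.2)) *
        sin (m * (q * z₁.arg - p * z₂.arg)) := by
  rw [mul_coeffMonomial_eq, Complex.im_ofReal_mul, Complex.exp_ofReal_mul_I_im, h₁, h₂]
  push_cast
  ring_nf

/-- The resonant multi-index of lowest degree. -/
def resonantIndex (p q : ℕ) : MultiIndexPair := ((q - 1, 0), (0, p))

theorem degree_resonantIndex (p q : ℕ) : degree (resonantIndex p q) = q - 1 + p := by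
  simp [degree, resonantIndex]

/-- Extracts the common factor from each non-leading term, with a spare factor `ρ`. The powers of
`t` put the bound in the form summed by `tsum_uSqHat_le`. -/
theorem abs_mul_coeffMonomial_im_le {z₁ z₂ : ℂ} {ρ : ℝ} (hz₁ : ‖z₁‖ ≤ ρ) (hz₂ : ‖z₂‖ ≤ ρ)
    {t : ℝ} (hρt : 4 * ρ ≤ t) {d p q : ℕ} (hd : 0 < d) (hp : 0 < p) (hpq' : p < q)
    (hpq : Nat.Coprime p q) {a : MultiIndexPair}
    (h : frequency (d * p) (d * q) a = -((d * p : ℕ) : ℤ)) (ha : a ≠ resonantIndex p q) :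
    |(z₁ * coeffMonomial z₁ z₂ a).im| * t ^ (q + p) ≤
      ‖z₁‖ ^ q * ‖z₂‖ ^ p * |sin (q * z₁.arg - p * z₂.arg)| * (4 ^ (q - 1 + p) * (4 * ρ)) *
        t ^ degree a := by
  have hρ : 0 ≤ ρ := (norm_nonneg _).trans hz₁
  have ht : 0 ≤ t := by linarith
  obtain ⟨m, h₁, h₂⟩ := frequency_eq_neg_iff hd (hp.trans hpq') hpq h
  rw [mul_coeffMonomial_im z₁ z₂ h₁ h₂]
  set S := sin (q * z₁.arg - p * z₂.arg) with hS
  obtain ⟨⟨a1, a2⟩, b1, b2⟩ := a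
  simp only [resonantIndex, ne_eq, Prod.mk.injEq, not_and, degree] at *
  rcases eq_or_ne m 0 with rfl | hm
  · simp only [Int.cast_zero, zero_mul, sin_zero, mul_zero, abs_zero]
    positivity
  -- For `m ≠ 0` the exponents reach `q` and `p`; excluding the leading index raises the total
  -- degree to at least `q + p`.
  have hbound : q ≤ a1 + b1 + 1 ∧ p ≤ a2 + b2 ∧ q + p ≤ a1 + a2 + (b1 + b2) ∧
      m.natAbs ≤ a1 + a2 + (b1 + b2) := by
    have hq1 : 1 ≤ q := by omega
    have hm' : m = 1 ∨ m = -1 ∨ 2 ≤ m ∨ m ≤ -2 := by omega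
    have hma : (m.natAbs : ℤ) ≤ p * m.natAbs := by
      have : (1 : ℤ) ≤ p := by exact_mod_cast hp
      nlinarith
    rcases hm' with rfl | rfl | hm' | hm'
    · have h3 : ¬(a1 = q - 1 ∧ a2 = 0 ∧ b1 = 0 ∧ b2 = p) := fun h => ha ⟨h.1, h.2.1⟩ h.2.2.1 h.2.2.2
      omega
    · omega
    · have h4 : (2 : ℤ) * q ≤ q * m := by nlinarith
      have h5 : (2 : ℤ) * p ≤ p * m := by nlinarith
      have : (m.natAbs : ℤ) = m := by omega
      rw [this] at hma
      omega
    · have h4 : q * m ≤ -(2 : ℤ) * q := by nlinarith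
      have h5 : p * m ≤ -(2 : ℤ) * p := by nlinarith
      have : (m.natAbs : ℤ) = -m := by omega
      rw [this, mul_neg] at hma
      omega
  obtain ⟨hb1, hb2, hb3, hb4⟩ := hbound
  obtain ⟨e1, he1⟩ := Nat.exists_eq_add_of_le hb1
  obtain ⟨e2, he2⟩ := Nat.exists_eq_add_of_le hb2
  set n := a1 + a2 + (b1 + b2) with hn
  have hne : e1 + e2 + (q - 1 + p) = n := by omega
  obtain ⟨e, he⟩ := Nat.exists_eq_add_of_le hb3
  have hee : e1 + e2 = e + 1 := by omega
  rw [abs_mul, abs_of_nonneg (by positivity :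
    (0 : ℝ) ≤ 2 ^ n * (‖z₁‖ ^ (a1 + b1 + 1) * ‖z₂‖ ^ (a2 + b2)))]
  -- The crude bound `|m| ≤ n ≤ 2 ^ n` makes the loss geometric; with the `2 ^ n` of the monomial it
  -- gives the powers of `4`.
  have s1 : |sin (m * (q * z₁.arg - p * z₂.arg))| ≤ 2 ^ n * |S| := by
    refine (abs_sin_int_mul_le _ _).trans ?_
    gcongr
    have : m.natAbs ≤ 2 ^ n := hb4.trans Nat.lt_two_pow_self.le
    exact_mod_cast this
  have s2 : ‖z₁‖ ^ (a1 + b1 + 1) * ‖z₂‖ ^ (a2 + b2) ≤ ‖z₁‖ ^ q * ‖z₂‖ ^ p * ρ ^ (e + 1) := by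
    rw [he1, he2, pow_add, pow_add, ← hee, pow_add]
    calc ‖z₁‖ ^ q * ‖z₁‖ ^ e1 * (‖z₂‖ ^ p * ‖z₂‖ ^ e2)
        ≤ ‖z₁‖ ^ q * ρ ^ e1 * (‖z₂‖ ^ p * ρ ^ e2) := by gcongr
      _ = _ := by ring
  calc 2 ^ n * (‖z₁‖ ^ (a1 + b1 + 1) * ‖z₂‖ ^ (a2 + b2)) *
        |sin (m * (q * z₁.arg - p * z₂.arg))| * t ^ (q + p)
      ≤ 2 ^ n * (‖z₁‖ ^ q * ‖z₂‖ ^ p * ρ ^ (e + 1)) * (2 ^ n * |S|) * t ^ (q + p) := by gcongr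
    _ = ‖z₁‖ ^ q * ‖z₂‖ ^ p * |S| * (4 ^ (q - 1 + p) * (4 * ρ)) * ((4 * ρ) ^ e * t ^ (q + p)) := by
        have : (2 : ℝ) ^ n * 2 ^ n = 4 ^ (q - 1 + p) * 4 * 4 ^ e := by
          rw [← mul_pow, ← pow_succ, ← pow_add]
          congr 1
          · norm_num
          · omega
        rw [mul_pow, pow_succ]
        linear_combination (‖z₁‖ ^ q * ‖z₂‖ ^ p * ρ ^ e * ρ * |S| * t ^ (q + p)) * this
    _ ≤ ‖z₁‖ ^ q * ‖z₂‖ ^ p * |S| * (4 ^ (q - 1 + p) * (4 * ρ)) * (t ^ e * t ^ (q + p)) := by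
        gcongr
    _ = _ := by rw [← pow_add, he, add_comm e]

/-- With `A` the common factor, the leading term and the sum of all others are equal in absolute
value; both scale with `A`, and `hφ` makes the leading multiple strictly larger, forcing `A = 0`. -/
theorem resonance_vanishes {l : ℤ → ℝ} {z₁ z₂ : ℂ} {K ρ t : ℝ} {d p q : ℕ} (hd : 0 < d)
    (hp : 0 < p) (hpq' : p < q) (hpq : Nat.Coprime p q) (hl : ∀ n, |l n| ≤ K)
    (hK : 16 * K * ρ ≤ 1) (h₁ : ‖z₁‖ ≤ ρ) (h₂ : ‖z₂‖ ≤ ρ) (ht : 0 < t) (hKt : 8 * K * t ≤ 1)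
    (hρt : 4 * ρ ≤ t)
    (hφ : 4 ^ (q - 1 + p) * (4 * ρ) * (4 * t) ^ 2 <
      |uSqHat (d * p) (d * q) l (resonantIndex p q)| * 2 ^ (q - 1 + p) * t ^ (q + p))
    (him : (z₁ * fourierCoeffOn Real.two_pi_pos
      (fun x => expansion (d * p) (d * q) l z₁ z₂ x ^ 2) (-((d * p : ℕ) : ℤ))).im = 0) :
    ‖z₁‖ ^ q * ‖z₂‖ ^ p * |sin (q * z₁.arg - p * z₂.arg)| = 0 := by
  set k₁ := d * p with hk₁
  set k₂ := d * q with hk₂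
  set A := ‖z₁‖ ^ q * ‖z₂‖ ^ p * |sin (q * z₁.arg - p * z₂.arg)| with hA
  have hA0 : 0 ≤ A := by positivity
  have hρ : 0 ≤ ρ := (norm_nonneg _).trans h₁
  have hs := Complex.hasSum_im ((hasSum_fourierCoeffOn_expansion_sq (k₁ := k₁) (k₂ := k₂)
    hl hK h₁ h₂ (-(k₁ : ℤ))).mul_left z₁)
  rw [him] at hs
  set f : MultiIndexPair → ℝ := fun a => (z₁ * if frequency k₁ k₂ a = -(k₁ : ℤ) then
    (uSqHat k₁ k₂ l a : ℂ) * coeffMonomial z₁ z₂ a else 0).im with hf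
  have hfa : ∀ a, frequency k₁ k₂ a = -(k₁ : ℤ) →
      f a = uSqHat k₁ k₂ l a * (z₁ * coeffMonomial z₁ z₂ a).im := fun a ha => by
    simp only [hf]
    rw [if_pos ha, mul_left_comm, Complex.im_ofReal_mul]
  have hfreq : frequency k₁ k₂ (resonantIndex p q) = -(k₁ : ℤ) := by
    have : ((q - 1 : ℕ) : ℤ) = q - 1 := by omega
    simp only [frequency, resonantIndex, this, hk₁, hk₂]
    push_cast
    ring
  have hlead : |f (resonantIndex p q)| =
      |uSqHat k₁ k₂ l (resonantIndex p q)| * 2 ^ (q - 1 + p) * A := by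
    rw [hfa _ hfreq, mul_coeffMonomial_im z₁ z₂ (p := p) (q := q) (m := 1)
      (by simp only [resonantIndex]; omega) (by simp only [resonantIndex]; omega), abs_mul,
      abs_mul, degree_resonantIndex, abs_of_nonneg (a := 2 ^ (q - 1 + p) * _) (by positivity)]
    simp only [resonantIndex, hA, Int.cast_one, one_mul, add_zero, zero_add]
    rw [Nat.sub_add_cancel (by omega)]
    ring
  have hdec := hs.summable.tsum_eq_add_tsum_ite (resonantIndex p q)
  rw [hs.tsum_eq] at hdec
  have hrest : ‖∑' a, (if a = resonantIndex p q then 0 else f a) * t ^ (q + p)‖ ≤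
      (A * (4 ^ (q - 1 + p) * (4 * ρ))) * (4 * t) ^ 2 := by
    have hsum := summable_uSqHat (k₁ := k₁) (k₂ := k₂) hl ht.le hKt
    refine (tsum_of_norm_bounded (hsum.hasSum.mul_left (A * (4 ^ (q - 1 + p) * (4 * ρ))))
      fun a => ?_).trans ?_
    · split_ifs with ha
      · rw [zero_mul, norm_zero]
        positivity
      · by_cases hfr : frequency k₁ k₂ a = -(k₁ : ℤ)
        · have := abs_mul_coeffMonomial_im_le h₁ h₂ hρt hd hp hpq' hpq hfr ha
          rw [hfa a hfr, norm_mul, norm_mul, norm_eq_abs, norm_eq_abs, norm_eq_abs,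
            abs_of_pos (pow_pos ht _)]
          calc _ = |uSqHat k₁ k₂ l a| *
                (|(z₁ * coeffMonomial z₁ z₂ a).im| * t ^ (q + p)) := by ring
            _ ≤ _ := mul_le_mul_of_nonneg_left this (abs_nonneg _)
            _ = _ := by rw [hA]; ring
        · simp only [hf, if_neg hfr, mul_zero, Complex.zero_im, zero_mul, norm_zero]
          positivity
    · have := tsum_uSqHat_le (k₁ := k₁) (k₂ := k₂) hl ht.le hKt
      gcongr
  rw [tsum_mul_right, norm_mul, norm_eq_abs, norm_eq_abs, abs_of_pos (pow_pos ht _)] at hrest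
  have heq : |f (resonantIndex p q)| = |∑' a, (if a = resonantIndex p q then 0 else f a)| := by
    rw [← abs_neg]
    congr 1
    linarith
  rw [← heq, hlead] at hrest
  by_contra hne
  have hApos : 0 < A := lt_of_le_of_ne hA0 (Ne.symm hne)
  have := mul_lt_mul_of_pos_left hφ hApos
  linarith

end CapillaryWhitham

/-! ### From the phase condition to symmetry. -/

namespace CapillaryWhitham

open MeasureTheory Real ComplexConjugate

theorem expMode_mul_im (n : ℤ) (x : ℝ) (z : ℂ) :
    (expMode n x * z).im = ‖z‖ * sin (n * x + z.arg) := by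
  conv_lhs => rw [← Complex.norm_mul_exp_arg_mul_I z]
  rw [mul_left_comm, Complex.im_ofReal_mul, expMode, ← Complex.exp_add, ← add_mul,
    ← Complex.exp_ofReal_mul_I_im]
  push_cast
  rfl

/-- If one coefficient vanishes, only one phase needs adjusting. Otherwise `q arg z₁ - p arg z₂ = N
π`, and Bézout's `a p + b q = 1` gives a translation after which the phases are `b N π` and `-a N
π`. -/
theorem exists_shift_real {z₁ z₂ : ℂ} {d p q : ℕ} (hd : 0 < d) (hp : 0 < p) (hq : 0 < q)
    (hpq : Nat.Coprime p q)
    (h : ‖z₁‖ ^ q * ‖z₂‖ ^ p * |sin (q * z₁.arg - p * z₂.arg)| = 0) :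
    ∃ x : ℝ, (expMode ((d * p : ℕ) : ℤ) x * z₁).im = 0 ∧
      (expMode ((d * q : ℕ) : ℤ) x * z₂).im = 0 := by
  have hd' : (d : ℝ) ≠ 0 := by exact_mod_cast hd.ne'
  have hp' : (p : ℝ) ≠ 0 := by exact_mod_cast hp.ne'
  have hq' : (q : ℝ) ≠ 0 := by exact_mod_cast hq.ne'
  simp only [expMode_mul_im, mul_eq_zero, pow_eq_zero_iff hp.ne', pow_eq_zero_iff hq.ne',
    norm_eq_zero, abs_eq_zero] at h ⊢
  push_cast
  rcases h with (h | h) | h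
  · refine ⟨-z₂.arg / (d * q), Or.inl h, Or.inr ?_⟩
    rw [show (d * q * (-z₂.arg / (d * q)) + z₂.arg : ℝ) = 0 by field_simp; ring, sin_zero]
  · refine ⟨-z₁.arg / (d * p), Or.inr ?_, Or.inl h⟩
    rw [show (d * p * (-z₁.arg / (d * p)) + z₁.arg : ℝ) = 0 by field_simp; ring, sin_zero]
  · obtain ⟨N, hN⟩ := sin_eq_zero_iff.1 h
    obtain ⟨a, b, hab⟩ := Nat.isCoprime_iff_coprime.2 hpq
    have hab' : (a * p + b * q : ℝ) = 1 := by exact_mod_cast hab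
    refine ⟨(((b * N : ℤ) : ℝ) * π - z₁.arg) / (d * p), Or.inr ?_, Or.inr ?_⟩
    · rw [show (d * p * ((((b * N : ℤ) : ℝ) * π - z₁.arg) / (d * p)) + z₁.arg : ℝ) =
        ((b * N : ℤ) : ℝ) * π by field_simp; ring]
      exact sin_int_mul_pi _
    · rw [show (d * q * ((((b * N : ℤ) : ℝ) * π - z₁.arg) / (d * p)) + z₂.arg : ℝ) =
        ((-(a * N) : ℤ) : ℝ) * π by
          field_simp
          push_cast
          linear_combination N * π * hab' + hN]
      exact sin_int_mul_pi _

theorem conj_expMode (n : ℤ) (x : ℝ) : conj (expMode n x) = expMode n (-x) := by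
  rw [expMode, expMode, ← Complex.exp_conj]
  simp only [map_mul, Complex.conj_ofReal, Complex.conj_I, map_intCast]
  push_cast
  ring_nf

theorem coeffMonomial_mul_expMode (k₁ k₂ : ℕ) (z₁ z₂ : ℂ) (a : MultiIndexPair) (x : ℝ) :
    coeffMonomial z₁ z₂ a * expMode (frequency k₁ k₂ a) x =
      coeffMonomial (expMode k₁ x * z₁) (expMode k₂ x * z₂) a := by
  have h : expMode (frequency k₁ k₂ a) x = expMode k₁ x ^ a.1.1 * expMode k₂ x ^ a.1.2 *
      (conj (expMode k₁ x) ^ a.2.1 * conj (expMode k₂ x) ^ a.2.2) := by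
    simp only [conj_expMode]
    simp only [expMode, ← Complex.exp_nat_mul, ← Complex.exp_add, frequency]
    push_cast
    ring_nf
  rw [h]
  simp only [coeffMonomial, map_mul, mul_pow]
  ring

theorem conj_coeffMonomial {z₁ z₂ : ℂ} (h₁ : z₁.im = 0) (h₂ : z₂.im = 0) (a : MultiIndexPair) :
    conj (coeffMonomial z₁ z₂ a) = coeffMonomial z₁ z₂ a := by
  simp only [coeffMonomial, map_mul, map_pow, Complex.conj_eq_iff_im.2 h₁,
    Complex.conj_eq_iff_im.2 h₂, Complex.conj_ofNat]

/-- Translation by `x₀` rotates `z₁`, `z₂` to real numbers; since `uHat` is real, all coefficients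
become real and reflection is conjugation. -/
theorem expansion_reflect {k₁ k₂ : ℕ} {l : ℤ → ℝ} {z₁ z₂ : ℂ} {x₀ : ℝ}
    (h₁ : (expMode k₁ x₀ * z₁).im = 0) (h₂ : (expMode k₂ x₀ * z₂).im = 0) (x : ℝ) :
    expansion k₁ k₂ l z₁ z₂ (-x + x₀) = conj (expansion k₁ k₂ l z₁ z₂ (x + x₀)) := by
  rw [expansion, expansion, Complex.conj_tsum]
  refine tsum_congr fun a => ?_
  have h : ∀ y, (uHat k₁ k₂ l a : ℂ) * coeffMonomial z₁ z₂ a *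
      expMode (frequency k₁ k₂ a) (y + x₀) = (uHat k₁ k₂ l a : ℂ) *
      coeffMonomial (expMode k₁ x₀ * z₁) (expMode k₂ x₀ * z₂) a *
      expMode (frequency k₁ k₂ a) y := fun y => by
    rw [expMode_sum, ← coeffMonomial_mul_expMode]
    ring
  rw [h, h, map_mul, map_mul, Complex.conj_ofReal, conj_coeffMonomial h₁ h₂, conj_expMode]

theorem isSymmetric_of_small {u : ℝ → ℝ} {c κ T K ρ t : ℝ} {d p q : ℕ} (hd : 0 < d) (hp : 0 < p)
    (hpq' : p < q) (hpq : Nat.Coprime p q) (hu : IsSolution u c κ T) (huρ : ∀ᵐ x, |u x| ≤ ρ)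
    (hK : ∀ n, |ell (d * p) (d * q) c κ T n| ≤ K) (hKρ : 16 * K * ρ ≤ 1)
    (hne : ∀ n : ℤ, n.natAbs ≠ d * p → n.natAbs ≠ d * q → symbol T (κ * n) ≠ c)
    (ht : 0 < t) (hKt : 8 * K * t ≤ 1) (hρt : 4 * ρ ≤ t)
    (hφ : 4 ^ (q - 1 + p) * (4 * ρ) * (4 * t) ^ 2 <
      |uSqHat (d * p) (d * q) (ell (d * p) (d * q) c κ T) (resonantIndex p q)| *
        2 ^ (q - 1 + p) * t ^ (q + p)) : IsSymmetric u := by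
  set k₁ := d * p with hk₁
  set k₂ := d * q with hk₂
  set l := ell k₁ k₂ c κ T with hl
  have hk₁' : 1 ≤ k₁ := Nat.mul_pos hd hp
  have hk : k₁ < k₂ := Nat.mul_lt_mul_of_pos_left hpq' hd
  have heq := ae_eq_expansion hk₁' hk hu huρ hK hKρ hne
  have h₁ := norm_fourierHat_le huρ k₁
  have h₂ := norm_fourierHat_le huρ k₂
  set z₁ := fourierHat u k₁ with hz₁
  set z₂ := fourierHat u k₂ with hz₂
  have hsq : fourierCoeffOn Real.two_pi_pos (fun x => expansion k₁ k₂ l z₁ z₂ x ^ 2) (-(k₁ : ℤ)) =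
      fourierHat (fun x => u x ^ 2) (-(k₁ : ℤ)) := by
    refine congrFun (fourierCoeffOn_congr_ae _ (ae_restrict_of_ae ?_)) _
    filter_upwards [heq] with x hx
    rw [← hx]
    push_cast
    rfl
  -- The linear part of the equation contributes a real multiple of `z₁ * conj z₁`.
  have him : (z₁ * fourierCoeffOn Real.two_pi_pos
      (fun x => expansion k₁ k₂ l z₁ z₂ x ^ 2) (-(k₁ : ℤ))).im = 0 := by
    have h := hu.eqn (-(k₁ : ℤ))
    rw [fourierHat_neg, ← hz₁, add_comm] at h
    rw [hsq, eq_neg_of_add_eq_zero_left h, mul_neg, mul_left_comm, Complex.mul_conj, Complex.neg_im,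
      ← Complex.ofReal_mul, Complex.ofReal_im, neg_zero]
  obtain ⟨x₀, hx₁, hx₂⟩ := exists_shift_real hd hp (hp.trans hpq') hpq
    (resonance_vanishes hd hp hpq' hpq hK hKρ h₁ h₂ ht hKt hρt hφ him)
  refine ⟨x₀, ?_⟩
  have hadd : ∀ᵐ x : ℝ, (u (x + x₀) : ℂ) = expansion k₁ k₂ l z₁ z₂ (x + x₀) :=
    (measurePreserving_add_right volume x₀).quasiMeasurePreserving.ae heq
  have hsub : ∀ᵐ x : ℝ, (u (-x + x₀) : ℂ) = expansion k₁ k₂ l z₁ z₂ (-x + x₀) :=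
    (Measure.measurePreserving_neg (volume : Measure ℝ)).quasiMeasurePreserving.ae hadd
  filter_upwards [hadd, hsub] with x hx hx'
  rw [expansion_reflect hx₁ hx₂, ← hx, Complex.conj_ofReal] at hx'
  exact_mod_cast hx'

end CapillaryWhitham

/-! ### Uniformity near the bifurcation point. -/

namespace CapillaryWhitham

open MeasureTheory Real Filter Topology

theorem continuousAt_symbol {c₀ κ₀ T₀ : ℝ} (hκ : 0 < κ₀) (n : ℤ) :
    ContinuousAt (fun x : ℝ × ℝ × ℝ => symbol x.2.2 (x.2.1 * n)) (c₀, κ₀, T₀) := by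
  rcases eq_or_ne n 0 with rfl | hn
  · simp only [Int.cast_zero, mul_zero, symbol_zero]
    exact continuousAt_const
  · have hn' : (n : ℝ) ≠ 0 := by exact_mod_cast hn
    have hev : (fun x : ℝ × ℝ × ℝ => √((1 + x.2.2 * (x.2.1 * n) ^ 2) *
        (sinh (x.2.1 * n) / cosh (x.2.1 * n)) / (x.2.1 * n))) =ᶠ[𝓝 (c₀, κ₀, T₀)]
        fun x => symbol x.2.2 (x.2.1 * n) := by
      have : ∀ᶠ x : ℝ × ℝ × ℝ in 𝓝 (c₀, κ₀, T₀), 0 < x.2.1 :=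
        (continuous_fst.comp continuous_snd).continuousAt.eventually_const_lt hκ
      filter_upwards [this] with x hx
      rw [symbol, if_neg (mul_ne_zero hx.ne' hn'), Real.tanh_eq_sinh_div_cosh]
    refine ContinuousAt.congr ?_ hev
    refine ContinuousAt.sqrt (ContinuousAt.div (ContinuousAt.mul (by fun_prop)
      (ContinuousAt.div (by fun_prop) (by fun_prop) (cosh_pos _).ne')) (by fun_prop) ?_)
    exact mul_ne_zero hκ.ne' hn'

/-- For `ξ ≥ 1` one has `tanh ξ ≥ 1/2`, so the squared symbol is at least `T ξ / 2`. -/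
theorem symbol_ge {T κ : ℝ} (hT : 0 < T) {n : ℤ} {B : ℝ}
    (h1 : 1 ≤ κ * n.natAbs) (h2 : 2 * B ^ 2 ≤ T * (κ * n.natAbs)) : B ≤ symbol T (κ * n) := by
  rw [symbol_mul_natAbs]
  set ξ := κ * n.natAbs with hξ
  have hξ0 : 0 < ξ := by linarith
  rw [symbol_eq hξ0]
  refine Real.le_sqrt_of_sq_le ?_
  have hs : ξ < sinh ξ := self_lt_sinh_iff.2 hξ0
  have hc : cosh ξ ≤ 2 * sinh ξ := by
    have h3 := cosh_sub_sinh ξ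
    have h4 : exp (-ξ) ≤ 1 := exp_le_one_iff.2 (by linarith)
    linarith
  have hth : 1 / 2 ≤ Real.tanh ξ := by
    rw [Real.tanh_eq_sinh_div_cosh, div_le_div_iff₀ two_pos (cosh_pos ξ)]
    linarith
  calc B ^ 2 ≤ T * ξ * (1 / 2) := by linarith
    _ ≤ T * ξ * Real.tanh ξ := by gcongr
    _ ≤ symbolSq T ξ := by
      rw [symbolSq, le_div_iff₀ hξ0]
      have := tanh_pos hξ0
      nlinarith

theorem IsDoubleBifurcationPoint.symbol_eq_symbol {k₁ k₂ : ℕ} {c₀ κ₀ T₀ : ℝ}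
    (h : IsDoubleBifurcationPoint k₁ k₂ c₀ κ₀ T₀) :
    symbol T₀ (κ₀ * k₁) = c₀ ∧ symbol T₀ (κ₀ * k₂) = c₀ :=
  ⟨(h.eq_iff k₁ h.one_le).2 (Or.inl rfl),
    (h.eq_iff k₂ (h.one_le.trans h.lt.le)).2 (Or.inr rfl)⟩

theorem IsDoubleBifurcationPoint.unimodal {k₁ k₂ : ℕ} {c₀ κ₀ T₀ : ℝ}
    (h : IsDoubleBifurcationPoint k₁ k₂ c₀ κ₀ T₀) :
    T₀ < 1 / 3 ∧ c₀ < 1 ∧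
      (∀ x, κ₀ * k₁ < x → x < κ₀ * k₂ → symbol T₀ x < c₀) ∧
      (∀ x, 0 < x → x < κ₀ * k₁ → c₀ < symbol T₀ x) ∧ (∀ x, κ₀ * k₂ < x → c₀ < symbol T₀ x) := by
  obtain ⟨h1, h2⟩ := h.symbol_eq_symbol
  have hk₁ : (0 : ℝ) < k₁ := by exact_mod_cast h.one_le
  have hk : (k₁ : ℝ) < k₂ := by exact_mod_cast h.lt
  have hκ := h.κ_pos
  have := symbol_unimodal (a := κ₀ * k₁) (b := κ₀ * k₂) h.T_pos (by positivity) (by gcongr)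
    (h1.trans h2.symm)
  rwa [h1] at this

theorem IsDoubleBifurcationPoint.symbol_ne {k₁ k₂ : ℕ} {c₀ κ₀ T₀ : ℝ}
    (h : IsDoubleBifurcationPoint k₁ k₂ c₀ κ₀ T₀) {n : ℤ} (h₁ : n.natAbs ≠ k₁)
    (h₂ : n.natAbs ≠ k₂) : symbol T₀ (κ₀ * n) ≠ c₀ := by
  -- The definition of a bifurcation point says nothing about `n = 0`; there `c₀ < 1 = m(0)` is
  -- used.
  rcases eq_or_ne n 0 with rfl | hn
  · simp only [Int.cast_zero, mul_zero, symbol_zero]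
    exact h.unimodal.2.1.ne'
  · rw [symbol_mul_natAbs, ne_eq, h.eq_iff _ (Int.natAbs_pos.2 hn)]
    exact not_or.2 ⟨h₁, h₂⟩

section

variable {k₁ k₂ : ℕ} {c₀ κ₀ T₀ : ℝ} (h : IsDoubleBifurcationPoint k₁ k₂ c₀ κ₀ T₀)
include h

theorem continuousAt_ell (n : ℤ) :
    ContinuousAt (fun x : ℝ × ℝ × ℝ => ell k₁ k₂ x.1 x.2.1 x.2.2 n) (c₀, κ₀, T₀) := by
  unfold ell
  split_ifs with hn
  · exact continuousAt_const
  · obtain ⟨h₁, h₂⟩ := not_or.1 hn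
    exact (continuousAt_fst.sub (continuousAt_symbol h.κ_pos n)).inv₀
      (sub_ne_zero.2 (h.symbol_ne h₁ h₂).symm)

theorem continuousAt_uHat (a : MultiIndexPair) :
    ContinuousAt (fun x : ℝ × ℝ × ℝ => uHat k₁ k₂ (ell k₁ k₂ x.1 x.2.1 x.2.2) a)
      (c₀, κ₀, T₀) := by
  induction hn : degree a using Nat.strong_induction_on generalizing a with
  | _ n ih =>
    simp only [uHat_eq _ _ _ a]
    split_ifs with ha
    · exact continuousAt_const
    · refine (continuousAt_ell h _).mul (tendsto_finsetSum _ fun b hb => ?_)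
      obtain ⟨hb0, hba⟩ := Finset.mem_Ioo.1 hb
      exact (ih _ (hn ▸ degree_lt hba) b rfl).mul (ih _ (hn ▸ degree_sub_lt hb0 hba) (a - b) rfl)

theorem continuousAt_uSqHat (a : MultiIndexPair) :
    ContinuousAt (fun x : ℝ × ℝ × ℝ => uSqHat k₁ k₂ (ell k₁ k₂ x.1 x.2.1 x.2.2) a)
      (c₀, κ₀, T₀) :=
  tendsto_finsetSum _ fun b _ => (continuousAt_uHat h b).mul (continuousAt_uHat h (a - b))

theorem eventually_nonresonant : ∃ K : ℝ, 0 < K ∧ ∀ᶠ x : ℝ × ℝ × ℝ in 𝓝 (c₀, κ₀, T₀),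
    (∀ n, |ell k₁ k₂ x.1 x.2.1 x.2.2 n| ≤ K) ∧
      ∀ n : ℤ, n.natAbs ≠ k₁ → n.natAbs ≠ k₂ → symbol x.2.2 (x.2.1 * n) ≠ x.1 := by
  have hc := h.c_pos
  have hκ := h.κ_pos
  have hT := h.T_pos
  obtain ⟨N₁, hN₁⟩ := exists_nat_ge (2 / κ₀)
  -- With `κ > κ₀/2` and `T > T₀/2`, frequencies beyond these thresholds have symbol at least `c₀ +
  -- 2`, one more than `c < c₀ + 1`; so `|ell| ≤ 1` there.
  obtain ⟨N₂, hN₂⟩ := exists_nat_ge (8 * (c₀ + 2) ^ 2 / (T₀ * κ₀))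
  set N := max N₁ N₂ with hN
  rw [div_le_iff₀ hκ] at hN₁
  rw [div_le_iff₀ (by positivity)] at hN₂
  set S : Finset ℤ := Finset.Icc (-N) N with hS
  set K : ℝ := ∑ n ∈ S, (|ell k₁ k₂ c₀ κ₀ T₀ n| + 1) + 1 with hK
  have hterm : ∀ n ∈ S, |ell k₁ k₂ c₀ κ₀ T₀ n| + 1 ≤ K := fun n hn => by
    have := Finset.single_le_sum (f := fun n => |ell k₁ k₂ c₀ κ₀ T₀ n| + 1)
      (fun m _ => by positivity) hn
    linarith
  have hK1 : 1 ≤ K := by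
    have : 0 ≤ ∑ n ∈ S, (|ell k₁ k₂ c₀ κ₀ T₀ n| + 1) := Finset.sum_nonneg fun n _ => by positivity
    linarith
  refine ⟨K, by linarith, ?_⟩
  have e1 : ∀ᶠ x : ℝ × ℝ × ℝ in 𝓝 (c₀, κ₀, T₀), ∀ n ∈ S, |ell k₁ k₂ x.1 x.2.1 x.2.2 n| ≤ K := by
    rw [Filter.eventually_all_finset]
    intro n hn
    filter_upwards [(continuousAt_ell h n).abs.eventually_lt_const
      (show _ < |ell k₁ k₂ c₀ κ₀ T₀ n| + 1 by dsimp only; linarith)] with x hx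
    exact hx.le.trans (hterm n hn)
  have e2 : ∀ᶠ x : ℝ × ℝ × ℝ in 𝓝 (c₀, κ₀, T₀), ∀ n ∈ S, n.natAbs ≠ k₁ → n.natAbs ≠ k₂ →
      symbol x.2.2 (x.2.1 * n) ≠ x.1 := by
    rw [Filter.eventually_all_finset]
    intro n _
    by_cases hn : n.natAbs ≠ k₁ ∧ n.natAbs ≠ k₂
    · filter_upwards [((continuousAt_symbol hκ n).sub continuousAt_fst).eventually_ne
        (sub_ne_zero.2 (h.symbol_ne hn.1 hn.2))] with x hx _ _
      exact sub_ne_zero.1 hx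
    · exact .of_forall fun x h₁ h₂ => absurd ⟨h₁, h₂⟩ hn
  have e3 : ∀ᶠ x : ℝ × ℝ × ℝ in 𝓝 (c₀, κ₀, T₀), x.1 < c₀ + 1 :=
    continuousAt_fst.eventually_lt_const (by dsimp only; linarith)
  have e4 : ∀ᶠ x : ℝ × ℝ × ℝ in 𝓝 (c₀, κ₀, T₀), κ₀ / 2 < x.2.1 :=
    (continuous_fst.comp continuous_snd).continuousAt.eventually_const_lt
      (by dsimp only [Function.comp]; linarith)
  have e5 : ∀ᶠ x : ℝ × ℝ × ℝ in 𝓝 (c₀, κ₀, T₀), T₀ / 2 < x.2.2 :=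
    (continuous_snd.comp continuous_snd).continuousAt.eventually_const_lt
      (by dsimp only [Function.comp]; linarith)
  filter_upwards [e1, e2, e3, e4, e5] with x h1 h2 h3 h4 h5
  have hlarge : ∀ n : ℤ, n ∉ S → c₀ + 2 ≤ symbol x.2.2 (x.2.1 * n) := fun n hn => by
    have hnN : N ≤ n.natAbs := by
      rw [hS, Finset.mem_Icc] at hn
      omega
    have hn1 : (N₁ : ℝ) ≤ n.natAbs := by exact_mod_cast (le_max_left _ _).trans hnN
    have hn2 : (N₂ : ℝ) ≤ n.natAbs := by exact_mod_cast (le_max_right _ _).trans hnN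
    have hx1 : 0 < x.2.1 := by linarith
    have hx2 : 0 < x.2.2 := by linarith
    refine symbol_ge hx2 ?_ ?_
    · calc (1 : ℝ) ≤ κ₀ / 2 * N₁ := by linarith
        _ ≤ x.2.1 * n.natAbs := by gcongr
    · calc 2 * (c₀ + 2) ^ 2 ≤ T₀ / 2 * (κ₀ / 2 * N₂) := by linarith
        _ ≤ x.2.2 * (x.2.1 * n.natAbs) := by gcongr
  refine ⟨fun n => ?_, fun n hn₁ hn₂ => ?_⟩
  · by_cases hn : n ∈ S
    · exact h1 n hn
    · refine le_trans ?_ hK1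
      rw [ell]
      split_ifs
      · simp
      · rw [abs_inv]
        refine inv_le_one_of_one_le₀ ?_
        rw [abs_sub_comm]
        exact le_abs.2 (Or.inl (by linarith [hlarge n hn]))
  · by_cases hn : n ∈ S
    · exact h2 n hn hn₁ hn₂
    · exact (by linarith [hlarge n hn] : x.1 < _).ne'

end

theorem noSmallAsymmetricSolutionsNear_of_ne_zero {d p q : ℕ} (hd : 0 < d) (hp : 0 < p)
    (hpq' : p < q) (hpq : Nat.Coprime p q) {c₀ κ₀ T₀ : ℝ}
    (h : IsDoubleBifurcationPoint (d * p) (d * q) c₀ κ₀ T₀)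
    (hφ : uSqHat (d * p) (d * q) (ell (d * p) (d * q) c₀ κ₀ T₀) (resonantIndex p q) ≠ 0) :
    NoSmallAsymmetricSolutionsNear c₀ κ₀ T₀ := by
  obtain ⟨K, hK, hev⟩ := eventually_nonresonant h
  set η := |uSqHat (d * p) (d * q) (ell (d * p) (d * q) c₀ κ₀ T₀) (resonantIndex p q)| with hη
  have hη0 : 0 < η := abs_pos.2 hφ
  have hev' := (continuousAt_uSqHat h (resonantIndex p q)).abs.eventually_const_lt
    (show η / 2 < _ from half_lt_self hη0)
  obtain ⟨δ, hδ, hball⟩ := Metric.eventually_nhds_iff.1 (hev.and hev')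
  set t : ℝ := 1 / (8 * K) with ht
  have ht0 : 0 < t := by positivity
  have hKt : 8 * K * t ≤ 1 := by rw [ht]; field_simp; rfl
  set A : ℝ := 4 ^ (q - 1 + p) * 4 * (4 * t) ^ 2 with hA
  set B : ℝ := η / 2 * 2 ^ (q - 1 + p) * t ^ (q + p) with hB
  have hA0 : 0 < A := by positivity
  have hB0 : 0 < B := by positivity
  -- `A ρ` bounds the remainder and `B` the leading term from below, both per unit of the common
  -- factor.
  set ρ : ℝ := min (t / 4) (B / (2 * A)) with hρ
  have hρ0 : 0 < ρ := lt_min (by positivity) (by positivity)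
  have hρ1 : 4 * ρ ≤ t := by linarith [min_le_left (t / 4) (B / (2 * A))]
  have hρ2 : A * ρ < B := by
    calc A * ρ ≤ A * (B / (2 * A)) := by gcongr; exact min_le_right _ _
      _ = B / 2 := by field_simp
      _ < B := half_lt_self hB0
  have hKρ : 16 * K * ρ ≤ 1 := by nlinarith
  refine ⟨min δ ρ, lt_min hδ hρ0, fun u c κ T hu hnorm hc hκ hT => not_not.2 ?_⟩
  have hdist : dist (c, κ, T) (c₀, κ₀, T₀) < δ := by
    simp only [Prod.dist_eq, Real.dist_eq, max_lt_iff]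
    exact ⟨hc.trans_le (min_le_left _ _), hκ.trans_le (min_le_left _ _),
      hT.trans_le (min_le_left _ _)⟩
  obtain ⟨⟨hell, hne⟩, hlow⟩ := hball hdist
  have huρ : ∀ᵐ x, |u x| ≤ ρ := by
    have h1 : eLpNorm u ⊤ (volume : Measure ℝ) ≤ ENNReal.ofReal ρ :=
      hnorm.le.trans (ENNReal.ofReal_le_ofReal (min_le_right _ _))
    rw [eLpNorm_exponent_top] at h1
    filter_upwards [ae_le_eLpNormEssSup (f := u) (μ := (volume : Measure ℝ))] with x hx
    have := hx.trans h1
    rw [← ofReal_norm, ENNReal.ofReal_le_ofReal_iff hρ0.le] at this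
    exact this
  refine isSymmetric_of_small hd hp hpq' hpq hu huρ hell hKρ hne ht0 hKt hρ1 ?_
  calc 4 ^ (q - 1 + p) * (4 * ρ) * (4 * t) ^ 2 = A * ρ := by rw [hA]; ring
    _ < B := hρ2
    _ ≤ _ := by
      rw [hB]
      gcongr

end CapillaryWhitham

/-! ### Nonvanishing of the leading coefficient by signs. -/

namespace CapillaryWhitham

theorem Ioo_zero_nonempty {a : MultiIndexPair} (ha : 2 ≤ degree a) :
    (Finset.Ioo 0 a).Nonempty := by
  have key : ∀ b : MultiIndexPair, degree b = 1 → b ≤ a → (Finset.Ioo 0 a).Nonempty :=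
    fun b hb hba => ⟨b, Finset.mem_Ioo.2 ⟨pos_iff_ne_zero.2 (by rintro rfl; simp [degree] at hb),
      lt_of_le_of_ne hba (by rintro rfl; omega)⟩⟩
  obtain ⟨⟨a1, a2⟩, a3, a4⟩ := a
  simp only [degree] at ha
  have : 1 ≤ a1 ∨ 1 ≤ a2 ∨ 1 ≤ a3 ∨ 1 ≤ a4 := by omega
  rcases this with h | h | h | h
  · exact key ((1, 0), (0, 0)) rfl (by simpa [Prod.mk_le_mk] using h)
  · exact key ((0, 1), (0, 0)) rfl (by simpa [Prod.mk_le_mk] using h)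
  · exact key ((0, 0), (1, 0)) rfl (by simpa [Prod.mk_le_mk] using h)
  · exact key ((0, 0), (0, 1)) rfl (by simpa [Prod.mk_le_mk] using h)

section

variable {k₁ k₂ : ℕ} {l : ℤ → ℝ} {s : ℝ} (hs : s * s = 1)
include hs

/-- The exponents `degree b + 1` and `degree (a - b) + 1` add to `degree a + 2`, and `s² = 1`, so
all products have the same sign. -/
theorem uSqHat_mul_pow_pos {a : MultiIndexPair} (ha : 2 ≤ degree a)
    (h : ∀ b, b ≠ 0 → b < a → 0 < uHat k₁ k₂ l b * s ^ (degree b + 1)) :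
    0 < uSqHat k₁ k₂ l a * s ^ degree a := by
  rw [uSqHat, Finset.sum_mul]
  refine Finset.sum_pos (fun b hb => ?_) (Ioo_zero_nonempty ha)
  obtain ⟨hb0, hba⟩ := Finset.mem_Ioo.1 hb
  have hle := add_tsub_cancel_of_le hba.le
  have h1 := h b hb0.ne' hba
  have h2 := h (a - b) (tsub_pos_of_lt hba).ne'
    (lt_of_le_of_ne tsub_le_self fun he => by
      have := degree_sub_lt hb0 hba
      rw [he] at this
      exact lt_irrefl _ this)
  have hd : s ^ degree a = s ^ (degree b + 1) * s ^ (degree (a - b) + 1) := by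
    conv_lhs => rw [← hle, degree_add]
    rw [pow_succ, pow_succ, mul_mul_mul_comm, hs, mul_one, pow_add]
  rw [hd, mul_mul_mul_comm]
  exact mul_pos h1 h2

/-- By induction each coefficient has the sign of `s ^ (degree + 1)`, since every further factor `l`
has the sign of `s`; no cancellation occurs. -/
theorem uSqHat_ne_zero_of_sign {a : MultiIndexPair} (ha : 2 ≤ degree a)
    (hl : ∀ b, b < a → 2 ≤ degree b → 0 < s * l (frequency k₁ k₂ b)) :
    uSqHat k₁ k₂ l a ≠ 0 := by
  have key : ∀ b, b ≠ 0 → b < a → 0 < uHat k₁ k₂ l b * s ^ (degree b + 1) := by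
    intro b
    induction hn : degree b using Nat.strong_induction_on generalizing b with
    | _ n ih =>
      intro hb0 hba
      subst hn
      have hd0 : degree b ≠ 0 := fun h => hb0 (degree_eq_zero h)
      rw [uHat_eq]
      split_ifs with hd
      · rw [hd, pow_succ, pow_one, hs]
        norm_num
      · have h2 : 2 ≤ degree b := by omega
        have h3 := uSqHat_mul_pow_pos (k₁ := k₁) (k₂ := k₂) (l := l) hs h2
          fun e he heb => ih _ (degree_lt heb) e rfl he (heb.trans hba)
        have h4 := mul_pos (hl b hba h2) h3
        rw [pow_succ]
        linarith
  exact left_ne_zero_of_mul (uSqHat_mul_pow_pos hs ha key).ne'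

end

theorem lt_resonantIndex {p q : ℕ} {b : MultiIndexPair} (h : b < resonantIndex p q) :
    ∃ i j : ℕ, b = ((i, 0), (0, j)) ∧ i ≤ q - 1 ∧ j ≤ p ∧ i + j < q - 1 + p := by
  have hd := degree_lt h
  have hle := h.le
  rw [degree_resonantIndex] at hd
  obtain ⟨⟨b1, b2⟩, b3, b4⟩ := b
  simp only [resonantIndex, Prod.mk_le_mk, degree] at hle hd
  obtain ⟨⟨h1, h2⟩, h3, h4⟩ := hle
  obtain rfl : b2 = 0 := by omega
  obtain rfl : b3 = 0 := by omega
  exact ⟨b1, b4, rfl, h1, h4, by omega⟩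

section

variable {k₁ k₂ : ℕ} {c₀ κ₀ T₀ : ℝ} (h : IsDoubleBifurcationPoint k₁ k₂ c₀ κ₀ T₀) {n : ℤ}
include h

theorem ell_pos (h₁ : k₁ < n.natAbs) (h₂ : n.natAbs < k₂) : 0 < ell k₁ k₂ c₀ κ₀ T₀ n := by
  rw [ell, if_neg (by omega), inv_pos, sub_pos, symbol_mul_natAbs]
  have hκ := h.κ_pos
  exact h.unimodal.2.2.1 _ (by gcongr) (by gcongr)

theorem ell_neg (hn : n.natAbs < k₁ ∨ k₂ < n.natAbs) : ell k₁ k₂ c₀ κ₀ T₀ n < 0 := by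
  have hlt := h.lt
  have hκ := h.κ_pos
  obtain ⟨-, hc, -, hleft, hright⟩ := h.unimodal
  rw [ell, if_neg (by omega), inv_lt_zero, sub_neg]
  rcases eq_or_ne n 0 with rfl | hn0
  · simpa [symbol_zero] using hc
  have hpos : (0 : ℝ) < n.natAbs := by exact_mod_cast Int.natAbs_pos.2 hn0
  rw [symbol_mul_natAbs]
  rcases hn with hn | hn
  · exact hleft _ (by positivity) (by gcongr)
  · exact hright _ (by gcongr)

end

theorem frequency_zero_zero (d p q i j : ℕ) :
    frequency (d * p) (d * q) ((i, 0), (0, j)) = d * ((p : ℤ) * i - q * j) := by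
  simp only [frequency]
  push_cast
  ring

/-- All intermediate frequencies are `d (i - q j)` with `j ≤ 1`, in absolute value strictly between
`k₁` and `k₂`, where `ell` is positive. -/
theorem uSqHat_ne_zero_of_dvd {d q : ℕ} (hq : 1 < q) {c₀ κ₀ T₀ : ℝ}
    (h : IsDoubleBifurcationPoint (d * 1) (d * q) c₀ κ₀ T₀) :
    uSqHat (d * 1) (d * q) (ell (d * 1) (d * q) c₀ κ₀ T₀) (resonantIndex 1 q) ≠ 0 := by
  have hd : 0 < d := by have := h.one_le; omega
  refine uSqHat_ne_zero_of_sign (s := 1) (one_mul 1) (by rw [degree_resonantIndex]; omega)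
    fun b hb hb2 => ?_
  obtain ⟨i, j, rfl, hi, hj, hij⟩ := lt_resonantIndex hb
  simp only [degree] at hb2
  rw [one_mul, frequency_zero_zero]
  have hj' : j = 0 ∨ j = 1 := by omega
  have : 1 < (((1 : ℕ) : ℤ) * i - q * j).natAbs ∧ (((1 : ℕ) : ℤ) * i - q * j).natAbs < q := by
    rcases hj' with rfl | rfl <;> push_cast <;> omega
  refine ell_pos h ?_ ?_ <;> rw [Int.natAbs_mul, Int.natAbs_natCast]
  · exact Nat.mul_lt_mul_of_pos_left this.1 hd
  · exact Nat.mul_lt_mul_of_pos_left this.2 hd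

/-- The opposite case: `p` and `p + 1` are adjacent, and the intermediate frequencies all avoid both
in absolute value, so they lie outside `[k₁, k₂]`, where `ell` is negative. -/
theorem uSqHat_ne_zero_of_sub_dvd {d p : ℕ} (hd : 0 < d) (hp : 0 < p) {c₀ κ₀ T₀ : ℝ}
    (h : IsDoubleBifurcationPoint (d * p) (d * (p + 1)) c₀ κ₀ T₀) :
    uSqHat (d * p) (d * (p + 1)) (ell (d * p) (d * (p + 1)) c₀ κ₀ T₀)
      (resonantIndex p (p + 1)) ≠ 0 := by
  refine uSqHat_ne_zero_of_sign (s := -1) (by norm_num) (by rw [degree_resonantIndex]; omega)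
    fun b hb hb2 => ?_
  obtain ⟨i, j, rfl, hi, hj, hij⟩ := lt_resonantIndex hb
  simp only [degree] at hb2
  rw [frequency_zero_zero, neg_one_mul, neg_pos]
  have hfreq : (p : ℤ) * i - (p + 1 : ℕ) * j = p * ((i : ℤ) - j) - j := by
    push_cast
    ring
  have : ((p : ℤ) * i - (p + 1 : ℕ) * j).natAbs < p ∨
      p + 1 < ((p : ℤ) * i - (p + 1 : ℕ) * j).natAbs := by
    rw [hfreq]
    -- `m = 0, 1` give values below `p`; all other `m` give values above `p + 1`.
    obtain ⟨m, hm⟩ : ∃ m : ℤ, m = (i : ℤ) - j := ⟨_, rfl⟩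
    rw [← hm]
    have hm' : m = 0 ∨ m = 1 ∨ m = -1 ∨ 2 ≤ m ∨ m ≤ -2 := by omega
    rcases hm' with rfl | rfl | rfl | hm' | hm'
    · omega
    · omega
    · omega
    · have : (2 : ℤ) * p ≤ p * m := by nlinarith
      omega
    · have : (p : ℤ) * m ≤ -2 * p := by nlinarith
      omega
  refine ell_neg h ?_
  rw [Int.natAbs_mul, Int.natAbs_natCast]
  exact this.imp (fun h => Nat.mul_lt_mul_of_pos_left h hd)
    fun h => Nat.mul_lt_mul_of_pos_left h hd

end CapillaryWhitham

theorem mainTheorem5 (k₁ k₂ : ℕ) (hk₁ : 1 ≤ k₁) (hk : k₁ < k₂) :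
    (Nat.Coprime k₁ k₂ → (∀ T ∈ Set.Ioo (0 : ℝ) (1 / 3), phi k₁ k₂ T ≠ 0) →
      ∀ c₀ κ₀ T₀ : ℝ, IsDoubleBifurcationPoint k₁ k₂ c₀ κ₀ T₀ →
        NoSmallAsymmetricSolutionsNear c₀ κ₀ T₀) ∧
    (k₁ ∣ k₂ ∨ (k₂ - k₁) ∣ k₁ →
      ∀ c₀ κ₀ T₀ : ℝ, IsDoubleBifurcationPoint k₁ k₂ c₀ κ₀ T₀ →
        NoSmallAsymmetricSolutionsNear c₀ κ₀ T₀) := by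
  refine ⟨fun hcop hphi c₀ κ₀ T₀ h => ?_, fun hdvd c₀ κ₀ T₀ h => ?_⟩
  · obtain ⟨h1, h2⟩ := h.symbol_eq_symbol
    have hκ : kappaZero k₁ k₂ T₀ = κ₀ := kappaZero_eq hk₁ hk h.T_pos h.κ_pos (h1.trans h2.symm)
    have hφ := hphi T₀ ⟨h.T_pos, h.unimodal.1⟩
    rw [phi, cZero, hκ, h1] at hφ
    refine noSmallAsymmetricSolutionsNear_of_ne_zero (d := 1) (p := k₁) (q := k₂) one_pos hk₁ hk
      hcop ?_ ?_
    · simpa only [one_mul] using h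
    · simpa only [one_mul, resonantIndex] using hφ
  · rcases hdvd with ⟨q, rfl⟩ | ⟨p, hp⟩
    · have hq : 1 < q := (Nat.lt_mul_iff_one_lt_right hk₁).1 hk
      have h' : IsDoubleBifurcationPoint (k₁ * 1) (k₁ * q) c₀ κ₀ T₀ := by rwa [mul_one]
      exact noSmallAsymmetricSolutionsNear_of_ne_zero hk₁ one_pos hq (Nat.coprime_one_left q) h'
        (uSqHat_ne_zero_of_dvd hq h')
    · have hd : 0 < k₂ - k₁ := Nat.sub_pos_of_lt hk
      have hp0 : 0 < p := Nat.pos_of_ne_zero fun h0 => by simp [h0] at hp; omega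
      -- With `d = k₂ - k₁` the wave numbers are `d p` and `d (p + 1)`, consecutive multiples and
      -- hence with coprime quotients.
      have hk₂ : k₂ = (k₂ - k₁) * (p + 1) := by rw [mul_add, ← hp]; omega
      generalize k₂ - k₁ = d at hp hd hk₂
      subst hp hk₂
      exact noSmallAsymmetricSolutionsNear_of_ne_zero hd hp0 (Nat.lt_succ_self p)
        (Nat.coprime_self_add_right.2 (Nat.coprime_one_right p)) h
        (uSqHat_ne_zero_of_sub_dvd hd hp0 h)
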